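/- **Setting.** Let $V_1,\dots,V_k$ be finite sets and let $\mu$ be a probability measure on $V_1\times\cdots\times V_k$. For $S\subseteq[k]$ let $\mu_S$ be the projection of $\mu$ on the coordinates in $S$, and let $V_S$ be the support of $\mu_S$. For $x\in V_S$ let the link $\mu_x$ be the conditional distribution of the coordinates outside $S$ of a sample $y\sim\mu$, given $y_S=x$. A probability measure $\nu$ on a product $U\times W$ of two finite sets is *$\epsilon$-pseudorandom* if for all $g\colon U\to\mathbb R$, $h\colon W\to\mathbb R$ $$\bigl|\mathbb E_{(u,w)\sim\nu}[g(u)h(w)]-\mathbb E_\nu[g(u)]\,\mathbb E_\nu[h(w)]\bigr|\le\epsilon\sqrt{\mathrm{Var}_\nu[g(u)]\,\mathrm{Var}_\nu[h(w)]}.$$ The measure $\mu$ is *$\epsilon$-product* if for every $S\subseteq[k]$ with $|S|\le k-2$, every $x\in V_S$ and all distinct $i,j\in[k]\setminus S$, the projection of $\mu_x$ on the coordinates $i,j$ is $\epsilon$-pseudorandom. For $f\colon V_1\times\cdots\times V_k\to\mathbb R$ and $T\subseteq[k]$ let $A_Tf(x)=\mathbb E_{y\sim\mu}[f(y)\mid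 y_T=x_T]$, and define $$f^{=S}=\sum_{T\subseteq S}(-1)^{|S\setminus T|}A_Tf,\qquad f^{\le d}=\sum_{|S|\le d}f^{=S},\qquad L_S^{\le d}[f]=\sum_{T\supseteq S,\ |T|\le d}f^{=T},$$ $$I_{S,x}^{\le d}[f]=\bigl\|L_S^{\le d}[f](x,\cdot)\bigr\|_{L^2(\mu_x)}^2\qquad(x\in V_S).$$ Norms $\|\cdot\|_p$ without further indication are those of $L^p(\mu)$; $\|f\|_\infty$ is the maximum of $|f|$ on the support of $\mu$. Let $X$ be a simplicial complex on a finite vertex set $V$ with at least one face with exactly $k$ vertices, and let $X(k)$ be the set of faces of $X$ with exactly $k$ vertices. The uniform measure on $X(k)$ is regarded as the uniform measure on the set of all tuples $(x_1,\dots,x_k)\in V^k$ with $\{x_1,\dots,x_k\}\in X(k)$ (so functions on $X(k)$ are the symmetric functions of these tuples). We call $X$ an *$\epsilon$-HDX* (at level $k$) if for every face $\sigma$ of $X$ with at most $k-2$ vertices, including $\sigma=\varnothing$, the following holds for the 1-skeleton of the link of $\sigma$, in which an edge $\{u,v\}$ has as its weight the number of faces in $X(k)$ that contain $\sigma\cup\{u,v\}$: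 all eigenvalues of the random walk on this weighted graph, except for the trivial eigenvalue $1$ of the constant functions, are at most $\epsilon$ in absolute value. **Theorem.** For every $k$ there is a constant $C_k>0$ such that the following two statements hold. 1. For all finite sets $V_1,\dots,V_k$, every real $\epsilon$, every $\epsilon$-product probability measure $\mu$ on $V_1\times\cdots\times V_k$, every integer $d\ge0$ and every $f\colon V_1\times\cdots\times V_k\to\mathbb R$, $$\|f^{\le d}\|_4^4\le20^d\sum_{|S|\le d}(4d)^{|S|}\,\mathbb E_{x\sim\mu_S}\Bigl[\bigl(I_{S,x}^{\le d}[f]\bigr)^2\Bigr]+C_k\,\epsilon^2\,\|f\|_2^2\,\|f\|_\infty^2,$$ where $S$ ranges over the subsets of $[k]$ of size at most $d$ and $0^0=1$. 2. For every finite simplicial complex $X$ with $X(k)\neq\varnothing$ that is an $\epsilon$-HDX, the same inequality holds with $\mu$ the uniform measure on $X(k)$, for every integer $d\ge0$ and every real-valued function $f$ of the tuples $(x_1,\dots,x_k)$. -/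

import Mathlib

open Finset

universe u

noncomputable section

namespace EpsProduct

/-! ### Finite weighted spaces -/

section Weighted

variable {α : Type*} [Fintype α]

/-- The expectation `𝔼_{a ∼ w} f a` for a weight function `w` on a finite set. -/
def wExpect (w f : α → ℝ) : ℝ := ∑ a, w a * f a

/-- The variance of `f` under the probability weights `w`. -/
def wVariance (w f : α → ℝ) : ℝ := wExpect w (fun a => (f a - wExpect w f) ^ 2)

/-- The `L^p` norm of `f` with respect to `w`, for a natural number `p ≥ 1`. -/
def lpNorm (p : ℕ) (w f : α → ℝ) : ℝ := (wExpect w (fun a => |f a| ^ p)) ^ (1 / (p : ℝ))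

/-- The `L^∞` norm of `f` with respect to `w`: the maximum of `|f|` on the support of `w`. -/
def supNorm (w f : α → ℝ) : ℝ := ⨆ a : {a : α // w a ≠ 0}, |f a|

end Weighted

/-- A weighted bipartite graph `ν` on `α × β` is `ε`-pseudorandom. Expectations and variances of
functions of one coordinate are those under the corresponding marginal of `ν`. -/
def IsPseudorandom {α β : Type*} [Fintype α] [Fintype β] (ε : ℝ) (ν : α × β → ℝ) : Prop :=
  ∀ (f₁ : α → ℝ) (f₂ : β → ℝ),
    |wExpect ν (fun p => f₁ p.1 * f₂ p.2)
        - wExpect ν (fun p => f₁ p.1) * wExpect ν (fun p => f₂ p.2)| ≤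
      ε * √(wVariance ν (fun p => f₁ p.1) * wVariance ν (fun p => f₂ p.2))

/-! ### Measures on `V 0 × ⋯ × V (k - 1)`: projections, links, `ε`-product measures -/

section Product

variable {k : ℕ} {V : Fin k → Type u} [∀ i, Fintype (V i)]

open scoped Classical in
/-- The projection `μ_S` of `μ` on the coordinates in `S`. -/
def proj (μ : (∀ i, V i) → ℝ) (S : Finset (Fin k)) (x : ∀ i : S, V i) : ℝ :=
  ∑ y : (∀ i, V i) with S.restrict y = x, μ y

open scoped Classical in
/-- The link `μ_x` of `x ∈ V_S`, that is, the conditional distribution of `μ` given that the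
coordinates in `S` are equal to `x`. It is regarded as a measure on full tuples `y`, carried by
those with `y_S = x`; dropping the coordinates in `S`, which are constant, identifies it with a
measure on the tuples indexed by the complement of `S`. -/
def link (μ : (∀ i, V i) → ℝ) (S : Finset (Fin k)) (x : ∀ i : S, V i) (y : ∀ i, V i) : ℝ :=
  if S.restrict y = x then μ y / proj μ S x else 0

open scoped Classical in
/-- The joint distribution of the coordinates `i` and `j` under `ν`. -/
def pairProj (ν : (∀ i, V i) → ℝ) (i j : Fin k) (p : V i × V j) : ℝ :=
  ∑ y : (∀ i, V i) with y i = p.1 ∧ y j = p.2, ν y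

/-- `μ` is an `ε`-product measure: for every `S` of size at most `k - 2` and every `x` in the
support of `μ_S`, all the two-dimensional projections of the link `μ_x` are `ε`-pseudorandom. -/
def IsEpsProduct (ε : ℝ) (μ : (∀ i, V i) → ℝ) : Prop :=
  ∀ S : Finset (Fin k), #S + 2 ≤ k → ∀ x : (∀ i : S, V i), proj μ S x ≠ 0 →
    ∀ i j : Fin k, i ∉ S → j ∉ S → i ≠ j → IsPseudorandom ε (pairProj (link μ S x) i j)

/-! ### The approximate Efron–Stein decomposition, Laplacians and influences -/

/-- The averaging operator `A_T f (x) = 𝔼_{y ∼ μ} [f y | y_T = x_T]`. -/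
def avg (μ : (∀ i, V i) → ℝ) (T : Finset (Fin k)) (f : (∀ i, V i) → ℝ) (x : ∀ i, V i) : ℝ :=
  wExpect (link μ T (T.restrict x)) f

/-- `f^{=S} = ∑_{T ⊆ S} (-1)^{|S \ T|} A_T f`. -/
def efronStein (μ : (∀ i, V i) → ℝ) (S : Finset (Fin k)) (f : (∀ i, V i) → ℝ)
    (x : ∀ i, V i) : ℝ :=
  ∑ T ∈ S.powerset, (-1) ^ #(S \ T) * avg μ T f x

/-- `f^{≤d} = ∑_{|S| ≤ d} f^{=S}`. -/
def lowDegree (μ : (∀ i, V i) → ℝ) (d : ℕ) (f : (∀ i, V i) → ℝ) (x : ∀ i, V i) : ℝ :=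
  ∑ S : Finset (Fin k) with #S ≤ d, efronStein μ S f x

/-- The low degree Laplacian `L_S^{≤d}[f] = ∑_{T ⊇ S, |T| ≤ d} f^{=T}`. -/
def lowDegreeLaplacian (μ : (∀ i, V i) → ℝ) (d : ℕ) (S : Finset (Fin k)) (f : (∀ i, V i) → ℝ)
    (x : ∀ i, V i) : ℝ :=
  ∑ T : Finset (Fin k) with S ⊆ T ∧ #T ≤ d, efronStein μ T f x

/-- The low degree influence `I_{S,x}^{≤d}[f]`, the squared norm in `L²(μ_x)` of the restriction
of `L_S^{≤d}[f]` to the tuples `y` with `y_S = x`. -/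
def lowDegreeInfluence (μ : (∀ i, V i) → ℝ) (d : ℕ) (S : Finset (Fin k)) (f : (∀ i, V i) → ℝ)
    (x : ∀ i : S, V i) : ℝ :=
  lpNorm 2 (link μ S x) (lowDegreeLaplacian μ d S f) ^ 2

end Product

/-! ### Simplicial complexes and high dimensional expanders

In this section a `k`-face of a complex is a face with exactly `k` vertices. -/

section Complex

variable {V : Type u} [Fintype V]

open scoped Classical in
/-- The uniform measure on the `k`-faces of `X`, as a measure on `V^k`: the uniform measure on the
tuples `(x₁, …, x_k)` whose entries are the `k` vertices of a `k`-face, in any order. -/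
def faceMeasure (X : PreAbstractSimplicialComplex V) (k : ℕ) (x : Fin k → V) : ℝ :=
  if Function.Injective x ∧ univ.image x ∈ X then
    1 / (#{y : Fin k → V | Function.Injective y ∧ univ.image y ∈ X} : ℝ)
  else 0

open scoped Classical in
/-- The weight of the edge `uv` in the 1-skeleton of the link of `σ`: the number of `k`-faces of
`X` that contain `σ ∪ {u, v}`. -/
def linkWeight (X : PreAbstractSimplicialComplex V) (k : ℕ) (σ : Finset V) (u v : V) : ℝ :=
  if u ∉ σ ∧ v ∉ σ ∧ u ≠ v then (#{τ : Finset V | τ ∈ X ∧ #τ = k ∧ σ ∪ {u, v} ⊆ τ} : ℝ) else 0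

/-- The weighted degree of `u` in the 1-skeleton of the link of `σ`. -/
def linkDegree (X : PreAbstractSimplicialComplex V) (k : ℕ) (σ : Finset V) (u : V) : ℝ :=
  ∑ v, linkWeight X k σ u v

/-- `ev` is a nontrivial eigenvalue of (the random walk on) the 1-skeleton of the link of `σ`: it
has an eigenfunction `g ≠ 0` on the vertices of this graph that is orthogonal to the constant
functions with respect to the stationary measure. -/
def IsNontrivialLinkEigenvalue (X : PreAbstractSimplicialComplex V) (k : ℕ) (σ : Finset V)
    (ev : ℝ) : Prop :=
  ∃ g : V → ℝ, g ≠ 0 ∧ (∀ u, linkDegree X k σ u = 0 → g u = 0) ∧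
    ∑ u, linkDegree X k σ u * g u = 0 ∧
    ∀ u, ∑ v, linkWeight X k σ u v * g v = ev * (linkDegree X k σ u * g u)

/-- The complex of the `k`-faces of `X` is an `ε`-HDX: in the 1-skeleton of the link of every face
`σ` with at most `k - 2` vertices (the empty face included), every eigenvalue other than the
trivial eigenvalue `1` of the constant functions is at most `ε` in absolute value. -/
def IsHDX (ε : ℝ) (k : ℕ) (X : PreAbstractSimplicialComplex V) : Prop :=
  ∀ σ : Finset V, (σ = ∅ ∨ σ ∈ X) → #σ + 2 ≤ k →
    ∀ ev : ℝ, IsNontrivialLinkEigenvalue X k σ ev → |ev| ≤ ε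

end Complex

end EpsProduct

end

/-!
The fourth moment of `F = f^{≤d}` is `‖F²‖₂²`, and by an approximate Parseval inequality it is at
most about the sum over `S` of `‖(F²)^{=S}‖₂²`. Everything rests on one analytic fact, proved by
conditioning on one coordinate at a time: for an `ε`-product measure `A_S A_T` equals `A_{S ∩ T}` up
to `O(ε)` in operator norm on `L²` (`IsEpsProduct.abs_wExpect_mul_sub_inter_le`). Consequently the
maps `f ↦ f^{=S}` are approximate projections, and `A_T f^{=S}` is small for `S ⊄ T`
(`IsEpsProduct.wExpect_avg_efronStein_sq_le`).

In `F² = ∑ f^{=T} f^{=T'}` only the pairs with `T ∆ T' ⊆ S ⊆ T ∪ T'` contribute to `(F²)^{=S}`; they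
are `T = A ∪ U`, `T' = B ∪ U` with `A ∪ B = S` and `U` outside `S`. For fixed `(A, B)`, Cauchy–Schwarz
over `U` and in the links of `S` bounds the contribution by a product of a function of the
coordinates in `A` and one of the coordinates in `B`. Given the coordinates in `R = A ∩ B` these are
nearly independent, so that the expectation of the product involves only their conditional
expectations on `R` (`IsEpsProduct.wExpect_efronStein_pairTerm_le`). There are `3 ^ #S` pairs
`(A, B)` for each `S`, and `3 ^ #S` factors over `R`, `A \ R` and `B \ R`; summing over `A` between
`R` and `T` yields `4 ^ #(T \ R)`, and in total `16 ^ d * ∑_R 3 ^ #R * E[I_R²]`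
(`sum_levelSq_mul_levelSq_le`).

The additive errors are of three kinds. Those in `L²` norm, of size `ε ‖f‖₂ ‖f‖_∞`, are squared at
the cost of a factor close to `1` on the main term. Those of first order in `ε` come with fourth
moments of the `f^{=T}`, which are controlled by that of `F` (`IsEpsProduct.fourthMoments_le`), so
that they are absorbed by the left-hand side when `ε` is small. For larger `ε` the bound is trivial.
The gap between `16 ^ d` and `20 ^ d` pays for both, except for `d = 0`, where there is equality.

For a complex, the pairs of coordinates in a link of the face measure are distributed like the edges
of the link, and the spectral theorem turns the bound on the nontrivial eigenvalues into
pseudorandomness (`isPseudorandom_of_eigenvalues`, `IsHDX.isEpsProduct`).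
-/

noncomputable section

namespace EpsProduct

/-! ### Expectations, variances and norms on finite weighted spaces -/

section Basic

variable {α : Type*} [Fintype α] {w : α → ℝ}

theorem wExpect_add (w f g : α → ℝ) : wExpect w (f + g) = wExpect w f + wExpect w g := by
  simp [wExpect, mul_add, sum_add_distrib]

theorem wExpect_sub (w f g : α → ℝ) : wExpect w (f - g) = wExpect w f - wExpect w g := by
  simp [wExpect, mul_sub, sum_sub_distrib]

theorem wExpect_smul (w f : α → ℝ) (c : ℝ) : wExpect w (c • f) = c * wExpect w f := by
  simp only [wExpect, mul_sum, Pi.smul_apply, smul_eq_mul]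
  exact sum_congr rfl fun _ _ => by ring

theorem wExpect_sum {ι : Type*} (s : Finset ι) (w : α → ℝ) (f : ι → α → ℝ) :
    wExpect w (∑ i ∈ s, f i) = ∑ i ∈ s, wExpect w (f i) := by
  simp only [wExpect, Finset.sum_apply, mul_sum]
  exact sum_comm

theorem wExpect_congr {f g : α → ℝ} (h : ∀ a, w a ≠ 0 → f a = g a) :
    wExpect w f = wExpect w g := by
  refine sum_congr rfl fun a _ => ?_
  by_cases ha : w a = 0
  · simp [ha]
  · rw [h a ha]

theorem wExpect_mono (hw : ∀ a, 0 ≤ w a) {f g : α → ℝ} (h : ∀ a, w a ≠ 0 → f a ≤ g a) :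
    wExpect w f ≤ wExpect w g := by
  refine sum_le_sum fun a _ => ?_
  by_cases ha : w a = 0
  · simp [ha]
  · exact mul_le_mul_of_nonneg_left (h a ha) (hw a)

theorem wExpect_nonneg (hw : ∀ a, 0 ≤ w a) {f : α → ℝ} (h : ∀ a, 0 ≤ f a) :
    0 ≤ wExpect w f :=
  sum_nonneg fun a _ => mul_nonneg (hw a) (h a)

theorem wExpect_sq_nonneg (hw : ∀ a, 0 ≤ w a) (f : α → ℝ) : 0 ≤ wExpect w (f ^ 2) :=
  wExpect_nonneg hw fun a => sq_nonneg (f a)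

theorem abs_wExpect_le (hw : ∀ a, 0 ≤ w a) (f : α → ℝ) :
    |wExpect w f| ≤ wExpect w (fun a => |f a|) := by
  refine (abs_sum_le_sum_abs _ _).trans (le_of_eq (sum_congr rfl fun a _ => ?_))
  rw [abs_mul, abs_of_nonneg (hw a)]

/-- The Cauchy–Schwarz inequality, in a form that also covers functions `h` which are only
dominated by the geometric mean of `f` and `g`. -/
theorem sq_wExpect_le_mul (hw : ∀ a, 0 ≤ w a) {f g h : α → ℝ} (hf : ∀ a, 0 ≤ f a)
    (hg : ∀ a, 0 ≤ g a) (hh : ∀ a, h a ^ 2 ≤ f a * g a) :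
    wExpect w h ^ 2 ≤ wExpect w f * wExpect w g := by
  refine sum_sq_le_sum_mul_sum_of_sq_le_mul _ (fun a _ => mul_nonneg (hw a) (hf a))
    (fun a _ => mul_nonneg (hw a) (hg a)) fun a _ => ?_
  nlinarith [mul_le_mul_of_nonneg_left (hh a) (mul_nonneg (hw a) (hw a))]

theorem sq_wExpect_mul_le (hw : ∀ a, 0 ≤ w a) (f g : α → ℝ) :
    wExpect w (f * g) ^ 2 ≤ wExpect w (f ^ 2) * wExpect w (g ^ 2) :=
  sq_wExpect_le_mul hw (fun a => sq_nonneg (f a)) (fun a => sq_nonneg (g a)) fun a => by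
    simp [mul_pow]

theorem abs_wExpect_mul_le (hw : ∀ a, 0 ≤ w a) (f g : α → ℝ) :
    |wExpect w (f * g)| ≤ √(wExpect w (f ^ 2)) * √(wExpect w (g ^ 2)) := by
  rw [← Real.sqrt_mul (wExpect_sq_nonneg hw f)]
  exact Real.abs_le_sqrt (sq_wExpect_mul_le hw f g)

theorem wExpect_sqrt_mul_sqrt_le (hw : ∀ a, 0 ≤ w a) {f g : α → ℝ} (hf : ∀ a, 0 ≤ f a)
    (hg : ∀ a, 0 ≤ g a) :
    wExpect w (fun a => √(f a) * √(g a)) ≤ √(wExpect w f) * √(wExpect w g) := by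
  rw [← Real.sqrt_mul (wExpect_nonneg hw hf)]
  refine Real.le_sqrt_of_sq_le (sq_wExpect_le_mul hw hf hg fun a => ?_)
  rw [mul_pow, Real.sq_sqrt (hf a), Real.sq_sqrt (hg a)]

theorem wExpect_sum_sq_le {ι : Type*} (hw : ∀ a, 0 ≤ w a) (s : Finset ι) (f : ι → α → ℝ) :
    wExpect w ((∑ i ∈ s, f i) ^ 2) ≤ #s * ∑ i ∈ s, wExpect w (f i ^ 2) := by
  rw [← wExpect_sum, ← wExpect_smul]
  refine wExpect_mono hw fun a _ => ?_
  simpa using sq_sum_le_card_mul_sum_sq (s := s) (f := fun i => f i a)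

theorem wExpect_sum_sq_le_of_le {ι : Type*} (hw : ∀ a, 0 ≤ w a) (s : Finset ι) (f : ι → α → ℝ)
    {N c : ℝ} (hN : #s ≤ N) (hc : 0 ≤ c) (h : ∀ i ∈ s, wExpect w (f i ^ 2) ≤ c) :
    wExpect w ((∑ i ∈ s, f i) ^ 2) ≤ N ^ 2 * c := by
  refine (wExpect_sum_sq_le hw s f).trans ?_
  have h1 : ∑ i ∈ s, wExpect w (f i ^ 2) ≤ #s * c := by
    simpa using sum_le_sum h
  have h0 : (0 : ℝ) ≤ #s := by positivity
  have hN0 : 0 ≤ N := h0.trans hN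
  calc (#s : ℝ) * ∑ i ∈ s, wExpect w (f i ^ 2) ≤ #s * (#s * c) := by gcongr
    _ ≤ N * (N * c) := by gcongr
    _ = N ^ 2 * c := by ring

/-- Adding a small function `g` costs a factor close to `1` on the second moment of `f`. -/
theorem wExpect_add_sq_le (hw : ∀ a, 0 ≤ w a) (f g : α → ℝ) {t : ℝ} (ht : 0 < t) :
    wExpect w ((f + g) ^ 2) ≤ (1 + t) * wExpect w (f ^ 2) + (1 + 1 / t) * wExpect w (g ^ 2) := by
  rw [← wExpect_smul, ← wExpect_smul, ← wExpect_add]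
  refine wExpect_mono hw fun a _ => ?_
  simp only [Pi.add_apply, Pi.pow_apply, Pi.smul_apply, smul_eq_mul]
  have h : 0 ≤ (t * f a - g a) ^ 2 / t := by positivity
  have h' : (t * f a - g a) ^ 2 / t = t * f a ^ 2 - 2 * f a * g a + 1 / t * g a ^ 2 := by
    field_simp
    ring
  nlinarith

theorem wVariance_le (hw1 : ∑ a, w a = 1) (f : α → ℝ) :
    wVariance w f ≤ wExpect w (f ^ 2) := by
  have h : wVariance w f = wExpect w (f ^ 2) - wExpect w f ^ 2 := by
    have h1 : (fun a => (f a - wExpect w f) ^ 2) =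
        f ^ 2 - (2 * wExpect w f) • f + (wExpect w f ^ 2) • (1 : α → ℝ) := by
      ext a
      simp
      ring
    rw [wVariance, h1, wExpect_add, wExpect_sub, wExpect_smul, wExpect_smul,
      show wExpect w (1 : α → ℝ) = 1 by simp [wExpect, hw1]]
    ring
  rw [h]
  linarith [sq_nonneg (wExpect w f)]

theorem wVariance_nonneg (hw : ∀ a, 0 ≤ w a) (f : α → ℝ) : 0 ≤ wVariance w f :=
  wExpect_nonneg hw fun _ => sq_nonneg _

theorem lpNorm_pow (hw : ∀ a, 0 ≤ w a) (f : α → ℝ) {p : ℕ} (hp : p ≠ 0) :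
    lpNorm p w f ^ p = wExpect w (fun a => |f a| ^ p) := by
  rw [lpNorm, one_div, Real.rpow_inv_natCast_pow _ hp]
  exact wExpect_nonneg hw fun a => by positivity

theorem lpNorm_two_sq (hw : ∀ a, 0 ≤ w a) (f : α → ℝ) :
    lpNorm 2 w f ^ 2 = wExpect w (f ^ 2) := by
  rw [lpNorm_pow hw f two_ne_zero]
  simp [wExpect]

theorem lpNorm_four_pow (hw : ∀ a, 0 ≤ w a) (f : α → ℝ) :
    lpNorm 4 w f ^ 4 = wExpect w (f ^ 4) := by
  rw [lpNorm_pow hw f four_ne_zero]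
  simp [wExpect, Even.pow_abs (show Even 4 by decide)]

theorem abs_le_supNorm (f : α → ℝ) {a : α} (ha : w a ≠ 0) : |f a| ≤ supNorm w f :=
  le_ciSup (f := fun a : {a : α // w a ≠ 0} => |f a|) (Set.finite_range _).bddAbove ⟨a, ha⟩

theorem supNorm_nonneg {α : Type*} {w : α → ℝ} (f : α → ℝ) : 0 ≤ supNorm w f :=
  Real.iSup_nonneg fun _ => abs_nonneg _

end Basic

/-! ### Links and averaging operators -/

section Avg

variable {k : ℕ} {V : Fin k → Type u} [∀ i, Fintype (V i)] {μ : (∀ i, V i) → ℝ}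

theorem restrict_eq_restrict_iff {k : ℕ} {V : Fin k → Type*} {S : Finset (Fin k)} {x y : ∀ i, V i} :
    S.restrict x = S.restrict y ↔ ∀ i ∈ S, x i = y i := by
  simp [funext_iff]

theorem proj_nonneg (hμ : ∀ x, 0 ≤ μ x) (S : Finset (Fin k)) (x : ∀ i : S, V i) :
    0 ≤ proj μ S x :=
  sum_nonneg fun y _ => hμ y

theorem le_proj (hμ : ∀ x, 0 ≤ μ x) (S : Finset (Fin k)) (y : ∀ i, V i) :
    μ y ≤ proj μ S (S.restrict y) := by
  classical
  exact single_le_sum (f := μ) (fun z _ => hμ z) (by simp)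

theorem proj_ne_zero (hμ : ∀ x, 0 ≤ μ x) (S : Finset (Fin k)) {y : ∀ i, V i} (hy : μ y ≠ 0) :
    proj μ S (S.restrict y) ≠ 0 :=
  (((hμ y).lt_of_ne' hy).trans_le (le_proj hμ S y)).ne'

theorem link_nonneg (hμ : ∀ x, 0 ≤ μ x) (S : Finset (Fin k)) (x : ∀ i : S, V i) (y : ∀ i, V i) :
    0 ≤ link μ S x y := by
  rw [link]
  split_ifs
  · exact div_nonneg (hμ y) (proj_nonneg hμ S x)
  · exact le_rfl

theorem ne_zero_of_link_ne_zero {S : Finset (Fin k)} {x : ∀ i : S, V i} {y : ∀ i, V i}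
    (h : link μ S x y ≠ 0) : μ y ≠ 0 ∧ S.restrict y = x := by
  rw [link] at h
  split_ifs at h with h1
  · exact ⟨fun h0 => h (by simp [h0]), h1⟩
  · exact absurd rfl h

theorem sum_link (S : Finset (Fin k)) {x : ∀ i : S, V i} (hx : proj μ S x ≠ 0) :
    ∑ y, link μ S x y = 1 := by
  classical
  simp only [link]
  rw [← sum_filter, ← sum_div]
  convert div_self hx
  rw [proj]

theorem sum_link_le (S : Finset (Fin k)) (x : ∀ i : S, V i) : ∑ y, link μ S x y ≤ 1 := by
  by_cases hx : proj μ S x = 0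
  · simp [link, hx]
  · exact (sum_link S hx).le

theorem avg_add (T : Finset (Fin k)) (f g : (∀ i, V i) → ℝ) :
    avg μ T (f + g) = avg μ T f + avg μ T g :=
  funext fun _ => wExpect_add _ f g

theorem avg_sub (T : Finset (Fin k)) (f g : (∀ i, V i) → ℝ) :
    avg μ T (f - g) = avg μ T f - avg μ T g :=
  funext fun _ => wExpect_sub _ f g

theorem avg_sum {ι : Type*} (s : Finset ι) (T : Finset (Fin k)) (f : ι → (∀ i, V i) → ℝ) :
    avg μ T (∑ i ∈ s, f i) = ∑ i ∈ s, avg μ T (f i) := by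
  ext x
  simp only [avg, wExpect_sum, Finset.sum_apply]

theorem avg_congr {T : Finset (Fin k)} {f g : (∀ i, V i) → ℝ} (h : ∀ x, μ x ≠ 0 → f x = g x) :
    avg μ T f = avg μ T g :=
  funext fun _ => wExpect_congr fun y hy => h y (ne_zero_of_link_ne_zero hy).1

theorem dependsOn_avg (T : Finset (Fin k)) (f : (∀ i, V i) → ℝ) : DependsOn (avg μ T f) T := by
  intro x y h
  rw [avg, avg, restrict_eq_restrict_iff.2 h]

theorem avg_mul_left {T : Finset (Fin k)} {h : (∀ i, V i) → ℝ} (hh : DependsOn h T)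
    (f : (∀ i, V i) → ℝ) : avg μ T (h * f) = h * avg μ T f := by
  ext x
  rw [Pi.mul_apply, avg, avg, ← wExpect_smul]
  refine wExpect_congr fun y hy => ?_
  rw [Pi.mul_apply, Pi.smul_apply, smul_eq_mul,
    hh (restrict_eq_restrict_iff.1 (ne_zero_of_link_ne_zero hy).2)]

/-- On the support of `μ` the averaging operator `A_T` fixes the functions of the coordinates
in `T`. -/
theorem avg_apply_of_dependsOn (hμ : ∀ x, 0 ≤ μ x) {T : Finset (Fin k)} {h : (∀ i, V i) → ℝ}
    (hh : DependsOn h T) {x : ∀ i, V i} (hx : μ x ≠ 0) : avg μ T h x = h x := by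
  have h1 := congrFun (avg_mul_left (μ := μ) hh 1) x
  rw [mul_one, Pi.mul_apply] at h1
  rw [h1, avg, wExpect]
  simp [sum_link T (proj_ne_zero hμ T hx)]

/-- The defining property of a conditional expectation. -/
theorem wExpect_avg_mul (hμ : ∀ x, 0 ≤ μ x) {T : Finset (Fin k)} {h : (∀ i, V i) → ℝ}
    (hh : DependsOn h T) (f : (∀ i, V i) → ℝ) :
    wExpect μ (avg μ T f * h) = wExpect μ (f * h) := by
  classical
  have h1 : ∀ x y, μ x * (link μ T (T.restrict x) y * f y * h x) =
      (if T.restrict x = T.restrict y then μ x else 0) *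
        (μ y * (f y * h y) / proj μ T (T.restrict y)) := by
    intro x y
    rw [link]
    by_cases hxy : T.restrict x = T.restrict y
    · rw [hh (restrict_eq_restrict_iff.1 hxy), if_pos hxy, if_pos hxy.symm, hxy]
      ring
    · rw [if_neg hxy, if_neg (Ne.symm hxy)]
      ring
  calc wExpect μ (avg μ T f * h) = ∑ x, ∑ y, μ x * (link μ T (T.restrict x) y * f y * h x) := by
        simp only [wExpect, avg, Pi.mul_apply, sum_mul, mul_sum]
    _ = ∑ y, ∑ x, (if T.restrict x = T.restrict y then μ x else 0) *
        (μ y * (f y * h y) / proj μ T (T.restrict y)) := by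
        rw [sum_comm]
        simp only [h1]
    _ = wExpect μ (f * h) := by
        refine sum_congr rfl fun y _ => ?_
        rw [← sum_mul, ← sum_filter, Pi.mul_apply]
        by_cases hy : μ y = 0
        · simp [hy]
        · have h2 := proj_ne_zero hμ T hy
          have h3 : ∑ x with T.restrict x = T.restrict y, μ x = proj μ T (T.restrict y) := by
            rw [proj]
          rw [h3]
          field_simp

theorem wExpect_avg_mul_avg (hμ : ∀ x, 0 ≤ μ x) (T : Finset (Fin k)) (f g : (∀ i, V i) → ℝ) :
    wExpect μ (avg μ T f * avg μ T g) = wExpect μ (f * avg μ T g) :=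
  wExpect_avg_mul hμ (dependsOn_avg T g) f

/-- The averaging operators are self-adjoint. -/
theorem wExpect_avg_mul_comm (hμ : ∀ x, 0 ≤ μ x) (T : Finset (Fin k)) (f g : (∀ i, V i) → ℝ) :
    wExpect μ (avg μ T f * g) = wExpect μ (f * avg μ T g) := by
  rw [← wExpect_avg_mul_avg hμ, mul_comm, ← wExpect_avg_mul_avg hμ T g f, mul_comm]

theorem wExpect_avg (hμ : ∀ x, 0 ≤ μ x) (T : Finset (Fin k)) (f : (∀ i, V i) → ℝ) :
    wExpect μ (avg μ T f) = wExpect μ f := by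
  simpa using wExpect_avg_mul hμ (T := T) (h := 1) (fun _ _ _ => rfl) f

theorem avg_nonneg (hμ : ∀ x, 0 ≤ μ x) (T : Finset (Fin k)) {f : (∀ i, V i) → ℝ}
    (h : ∀ x, 0 ≤ f x) (x : ∀ i, V i) : 0 ≤ avg μ T f x :=
  wExpect_nonneg (link_nonneg hμ T _) h

theorem avg_sq_le (hμ : ∀ x, 0 ≤ μ x) (T : Finset (Fin k)) (f : (∀ i, V i) → ℝ)
    (x : ∀ i, V i) : avg μ T f x ^ 2 ≤ avg μ T (f ^ 2) x := by
  have h := sq_wExpect_mul_le (link_nonneg hμ T (T.restrict x)) f 1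
  rw [mul_one] at h
  have h1 : wExpect (link μ T (T.restrict x)) (1 ^ 2) ≤ 1 := by
    simpa [wExpect] using sum_link_le (μ := μ) T (T.restrict x)
  exact h.trans (mul_le_of_le_one_right (wExpect_sq_nonneg (link_nonneg hμ T _) f) h1)

theorem wExpect_avg_sq_le (hμ : ∀ x, 0 ≤ μ x) (T : Finset (Fin k)) (f : (∀ i, V i) → ℝ) :
    wExpect μ (avg μ T f ^ 2) ≤ wExpect μ (f ^ 2) := by
  rw [← wExpect_avg hμ T (f ^ 2)]
  exact wExpect_mono hμ fun x _ => avg_sq_le hμ T f x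

theorem wExpect_avg_pow_four_le (hμ : ∀ x, 0 ≤ μ x) (T : Finset (Fin k))
    (f : (∀ i, V i) → ℝ) : wExpect μ (avg μ T f ^ 4) ≤ wExpect μ (f ^ 4) := by
  rw [← wExpect_avg hμ T (f ^ 4)]
  refine wExpect_mono hμ fun x _ => ?_
  have h1 := avg_sq_le hμ T f x
  have h2 := avg_sq_le hμ T (f ^ 2) x
  rw [← pow_mul] at h2
  calc avg μ T f x ^ 4 = (avg μ T f x ^ 2) ^ 2 := by ring
    _ ≤ avg μ T (f ^ 2) x ^ 2 := by gcongr
    _ ≤ _ := h2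

theorem abs_avg_le (hμ : ∀ x, 0 ≤ μ x) (T : Finset (Fin k)) {f : (∀ i, V i) → ℝ} {M : ℝ}
    (hM : 0 ≤ M) (h : ∀ x, μ x ≠ 0 → |f x| ≤ M) (x : ∀ i, V i) : |avg μ T f x| ≤ M := by
  refine (abs_wExpect_le (link_nonneg hμ T _) f).trans ?_
  calc wExpect (link μ T (T.restrict x)) (fun a => |f a|)
      ≤ wExpect (link μ T (T.restrict x)) (fun _ => M) :=
        wExpect_mono (link_nonneg hμ T _) fun y hy => h y (ne_zero_of_link_ne_zero hy).1
    _ = (∑ y, link μ T (T.restrict x) y) * M := by rw [wExpect, sum_mul]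
    _ ≤ 1 * M := by gcongr; exact sum_link_le T _
    _ = M := one_mul M

/-- The tower property. -/
theorem avg_avg (hμ : ∀ x, 0 ≤ μ x) {S T : Finset (Fin k)} (h : S ⊆ T)
    (f : (∀ i, V i) → ℝ) : avg μ S (avg μ T f) = avg μ S f := by
  classical
  ext x
  -- the density of the link of `x` with respect to `μ` is a function of the coordinates in `S`
  have key : ∀ g : (∀ i, V i) → ℝ, avg μ S g x = wExpect μ
      (g * fun y => if S.restrict y = S.restrict x then (proj μ S (S.restrict x))⁻¹ else 0) := by
    intro g
    refine sum_congr rfl fun y _ => ?_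
    rw [link, Pi.mul_apply]
    split_ifs
    · ring
    · ring
  rw [key, key]
  refine wExpect_avg_mul hμ (fun y z hyz => ?_) f
  have : S.restrict y = S.restrict z := restrict_eq_restrict_iff.2 fun i hi => hyz i (h hi)
  simp only [this]

theorem wExpect_proj (S : Finset (Fin k)) (φ : (∀ i : S, V i) → ℝ) :
    wExpect (proj μ S) φ = wExpect μ (fun y => φ (S.restrict y)) := by
  classical
  simp only [wExpect, proj, sum_mul]
  rw [← sum_fiberwise (s := univ) (g := fun y : (∀ i, V i) => S.restrict y)]
  refine sum_congr rfl fun x _ => ?_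
  refine sum_congr (by congr!) fun y hy => ?_
  rw [(mem_filter.1 hy).2]

theorem wExpect_pairProj (ν : (∀ i, V i) → ℝ) (i j : Fin k) (F : V i × V j → ℝ) :
    wExpect (pairProj ν i j) F = wExpect ν (fun y => F (y i, y j)) := by
  classical
  simp only [wExpect, pairProj, sum_mul]
  rw [← sum_fiberwise (s := univ) (g := fun y : (∀ i, V i) => (y i, y j))]
  refine sum_congr rfl fun p _ => ?_
  refine sum_congr (by ext y; simp [Prod.ext_iff]) fun y hy => ?_
  have := (mem_filter.1 hy).2
  rw [this]

end Avg

/-! ### Approximate independence of blocks of coordinates -/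

section Decorrelation

variable {k : ℕ} {V : Fin k → Type u} [∀ i, Fintype (V i)] {μ : (∀ i, V i) → ℝ} {ε : ℝ}

theorem IsEpsProduct.mono (h : IsEpsProduct ε μ) {ε' : ℝ} (hε : ε ≤ ε') : IsEpsProduct ε' μ :=
  fun S hS x hx i j hi hj hij f g => (h S hS x hx i j hi hj hij f g).trans
    (mul_le_mul_of_nonneg_right hε (Real.sqrt_nonneg _))

/-- Pseudorandomness of the link of `x_B`, for functions of the coordinates in `B` and of one more
coordinate each. -/
theorem IsEpsProduct.abs_avg_mul_sub_le (h : IsEpsProduct ε μ) (hε : 0 ≤ ε) (hμ : ∀ x, 0 ≤ μ x)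
    {B : Finset (Fin k)} {i j : Fin k} (hi : i ∉ B) (hj : j ∉ B) (hij : i ≠ j)
    {u v : (∀ i, V i) → ℝ} (hu : DependsOn u (insert i B : Finset (Fin k)))
    (hv : DependsOn v (insert j B : Finset (Fin k))) {x : ∀ i, V i} (hx : μ x ≠ 0) :
    |avg μ B (u * v) x - avg μ B u x * avg μ B v x| ≤
      ε * (√(avg μ B (u ^ 2) x) * √(avg μ B (v ^ 2) x)) := by
  have hcard : #B + 2 ≤ k := by
    have h1 : #(insert i (insert j B)) ≤ k := by
      simpa using card_le_univ (insert i (insert j B))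
    rwa [card_insert_of_notMem (by simp [hij, hi]), card_insert_of_notMem hj] at h1
  have hν := link_nonneg hμ B (B.restrict x)
  have hν1 := sum_link B (proj_ne_zero hμ B hx)
  -- in the link, `u` and `v` are functions of the coordinates `i` and `j`
  have key : ∀ (l : Fin k) (w : (∀ i, V i) → ℝ), DependsOn w (insert l B : Finset (Fin k)) →
      ∀ y, link μ B (B.restrict x) y ≠ 0 → w (Function.update x l (y l)) = w y := by
    intro l w hw y hy
    refine hw fun m hm => ?_
    by_cases hml : m = l
    · subst hml
      simp
    · rw [Function.update_of_ne hml]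
      have hm' : m ∈ B := by simpa [hml] using hm
      exact (restrict_eq_restrict_iff.1 (ne_zero_of_link_ne_zero hy).2 m hm').symm
  have h1 := h B hcard _ (proj_ne_zero hμ B hx) i j hi hj hij
    (fun a => u (Function.update x i a)) (fun b => v (Function.update x j b))
  have hvar : ∀ F : V i × V j → ℝ, wVariance (pairProj (link μ B (B.restrict x)) i j) F =
      wVariance (link μ B (B.restrict x)) (fun y => F (y i, y j)) := by
    intro F
    simp only [wVariance, wExpect_pairProj]
  simp only [wExpect_pairProj, hvar] at h1
  rw [wExpect_congr (g := u * v) fun y hy => by rw [key i u hu y hy, key j v hv y hy]; rfl,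
    wExpect_congr (g := u) fun y hy => key i u hu y hy,
    wExpect_congr (g := v) fun y hy => key j v hv y hy] at h1
  refine h1.trans (mul_le_mul_of_nonneg_left ?_ hε)
  rw [Real.sqrt_mul (wVariance_nonneg hν _)]
  have hu2 : wVariance (link μ B (B.restrict x)) (fun y => u (Function.update x i (y i))) ≤
      avg μ B (u ^ 2) x := by
    refine (wVariance_le hν1 _).trans (le_of_eq (wExpect_congr fun y hy => ?_))
    simp only [Pi.pow_apply, key i u hu y hy]
  have hv2 : wVariance (link μ B (B.restrict x)) (fun y => v (Function.update x j (y j))) ≤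
      avg μ B (v ^ 2) x := by
    refine (wVariance_le hν1 _).trans (le_of_eq (wExpect_congr fun y hy => ?_))
    simp only [Pi.pow_apply, key j v hv y hy]
  gcongr

/-- The preceding bound in expectation over `x_B`. -/
theorem IsEpsProduct.abs_wExpect_mul_sub_le_of_insert (h : IsEpsProduct ε μ) (hε : 0 ≤ ε)
    (hμ : ∀ x, 0 ≤ μ x) {B : Finset (Fin k)} {i j : Fin k} (hi : i ∉ B) (hj : j ∉ B)
    (hij : i ≠ j) {u v : (∀ i, V i) → ℝ} (hu : DependsOn u (insert i B : Finset (Fin k)))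
    (hv : DependsOn v (insert j B : Finset (Fin k))) :
    |wExpect μ (u * v) - wExpect μ (avg μ B u * avg μ B v)| ≤
      ε * (√(wExpect μ (u ^ 2)) * √(wExpect μ (v ^ 2))) := by
  rw [← wExpect_avg hμ B (u * v), ← wExpect_sub]
  calc _ ≤ wExpect μ (fun x => |(avg μ B (u * v) - avg μ B u * avg μ B v) x|) :=
        abs_wExpect_le hμ _
    _ ≤ wExpect μ (ε • fun x => √(avg μ B (u ^ 2) x) * √(avg μ B (v ^ 2) x)) :=
        wExpect_mono hμ fun x hx => h.abs_avg_mul_sub_le hε hμ hi hj hij hu hv hx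
    _ ≤ _ := by
        rw [wExpect_smul, ← wExpect_avg hμ B (u ^ 2), ← wExpect_avg hμ B (v ^ 2)]
        exact mul_le_mul_of_nonneg_left (wExpect_sqrt_mul_sqrt_le hμ
          (avg_nonneg hμ B fun _ => sq_nonneg _) (avg_nonneg hμ B fun _ => sq_nonneg _)) hε

theorem wExpect_avg_mul_avg_of_dependsOn (hμ : ∀ x, 0 ≤ μ x) {B : Finset (Fin k)}
    (u : (∀ i, V i) → ℝ) {v : (∀ i, V i) → ℝ} (hv : DependsOn v B) :
    wExpect μ (avg μ B u * avg μ B v) = wExpect μ (u * v) := by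
  rw [← wExpect_avg_mul hμ hv]
  refine wExpect_congr fun x hx => ?_
  rw [Pi.mul_apply, Pi.mul_apply, avg_apply_of_dependsOn hμ hv hx]

theorem sqrt_wExpect_avg_sq_le (hμ : ∀ x, 0 ≤ μ x) (T : Finset (Fin k))
    (f : (∀ i, V i) → ℝ) : √(wExpect μ (avg μ T f ^ 2)) ≤ √(wExpect μ (f ^ 2)) :=
  Real.sqrt_le_sqrt (wExpect_avg_sq_le hμ T f)

theorem IsEpsProduct.abs_wExpect_mul_sub_le_of_union_insert (h : IsEpsProduct ε μ) (hε : 0 ≤ ε)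
    (hμ : ∀ x, 0 ≤ μ x) {i : Fin k} (T : Finset (Fin k)) :
    ∀ {B : Finset (Fin k)}, i ∉ B → i ∉ T → Disjoint B T → ∀ {u v : (∀ i, V i) → ℝ},
    DependsOn u (insert i B : Finset (Fin k)) → DependsOn v (B ∪ T : Finset (Fin k)) →
    |wExpect μ (u * v) - wExpect μ (avg μ B u * avg μ B v)| ≤
      #T * ε * (√(wExpect μ (u ^ 2)) * √(wExpect μ (v ^ 2))) := by
  induction T using Finset.induction with
  | empty =>
    intro B hi _ _ u v hu hv
    rw [union_empty] at hv
    simp [wExpect_avg_mul_avg_of_dependsOn hμ u hv]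
  | insert j T hjT ih =>
    intro B hi hiT hBT u v hu hv
    simp only [mem_insert, not_or] at hiT
    rw [disjoint_insert_right] at hBT
    have h1 := @ih (insert j B) (by simp [hi, hiT.1]) hiT.2
      (disjoint_insert_left.2 ⟨hjT, hBT.2⟩) u v
      (hu.mono (by exact_mod_cast insert_subset_insert i (subset_insert j B)))
      (by rwa [insert_union, ← union_insert])
    have h2 := h.abs_wExpect_mul_sub_le_of_insert hε hμ hi hBT.1 hiT.1 hu
      (dependsOn_avg (μ := μ) (insert j B) v)
    rw [wExpect_avg_mul_avg hμ] at h1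
    rw [avg_avg hμ (subset_insert j B)] at h2
    rw [card_insert_of_notMem hjT]
    push_cast
    have h3 := sqrt_wExpect_avg_sq_le hμ (insert j B) v
    have h4 : ε * (√(wExpect μ (u ^ 2)) * √(wExpect μ (avg μ (insert j B) v ^ 2))) ≤
        ε * (√(wExpect μ (u ^ 2)) * √(wExpect μ (v ^ 2))) := by gcongr
    have h5 := abs_sub_le (wExpect μ (u * v)) (wExpect μ (u * avg μ (insert j B) v))
      (wExpect μ (avg μ B u * avg μ B v))
    linarith

/-- The `ε`-product condition for blocks of coordinates, by conditioning on one coordinate at a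
time. -/
theorem IsEpsProduct.abs_wExpect_mul_sub_le_of_union (h : IsEpsProduct ε μ) (hε : 0 ≤ ε)
    (hμ : ∀ x, 0 ≤ μ x) {T : Finset (Fin k)} (S : Finset (Fin k)) :
    ∀ {B : Finset (Fin k)}, Disjoint B S → Disjoint B T → Disjoint S T →
    ∀ {u v : (∀ i, V i) → ℝ}, DependsOn u (B ∪ S : Finset (Fin k)) →
    DependsOn v (B ∪ T : Finset (Fin k)) →
    |wExpect μ (u * v) - wExpect μ (avg μ B u * avg μ B v)| ≤
      #S * (#T * ε) * (√(wExpect μ (u ^ 2)) * √(wExpect μ (v ^ 2))) := by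
  induction S using Finset.induction with
  | empty =>
    intro B _ _ _ u v hu hv
    rw [union_empty] at hu
    rw [mul_comm (avg μ B u), wExpect_avg_mul_avg_of_dependsOn hμ v hu, mul_comm v]
    simp
  | insert i S hiS ih =>
    intro B hBS hBT hST u v hu hv
    rw [disjoint_insert_right] at hBS
    rw [disjoint_insert_left] at hST
    have h1 := @ih (insert i B) (disjoint_insert_left.2 ⟨hiS, hBS.2⟩)
      (disjoint_insert_left.2 ⟨hST.1, hBT⟩) hST.2 u v
      (by rwa [insert_union, ← union_insert])
      (hv.mono (by exact_mod_cast union_subset_union_left (subset_insert i B)))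
    have h2 := h.abs_wExpect_mul_sub_le_of_union_insert hε hμ T hBS.1 hST.1 hBT
      (dependsOn_avg (μ := μ) (insert i B) u) hv
    rw [mul_comm (avg μ (insert i B) u), wExpect_avg_mul_avg hμ, mul_comm v] at h1
    rw [avg_avg hμ (subset_insert i B)] at h2
    rw [card_insert_of_notMem hiS]
    push_cast
    have h3 := sqrt_wExpect_avg_sq_le hμ (insert i B) u
    have h4 : #T * ε * (√(wExpect μ (avg μ (insert i B) u ^ 2)) * √(wExpect μ (v ^ 2))) ≤
        #T * ε * (√(wExpect μ (u ^ 2)) * √(wExpect μ (v ^ 2))) := by gcongr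
    have h5 := abs_sub_le (wExpect μ (u * v)) (wExpect μ (avg μ (insert i B) u * v))
      (wExpect μ (avg μ B u * avg μ B v))
    linarith

/-- `A_S A_T` is close to `A_{S ∩ T}`, as a statement about bilinear forms. -/
theorem IsEpsProduct.abs_wExpect_mul_sub_inter_le (h : IsEpsProduct ε μ) (hε : 0 ≤ ε)
    (hμ : ∀ x, 0 ≤ μ x) {S T : Finset (Fin k)} {u v : (∀ i, V i) → ℝ} (hu : DependsOn u S)
    (hv : DependsOn v T) :
    |wExpect μ (u * v) - wExpect μ (avg μ (S ∩ T) u * avg μ (S ∩ T) v)| ≤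
      k ^ 2 * ε * (√(wExpect μ (u ^ 2)) * √(wExpect μ (v ^ 2))) := by
  refine (h.abs_wExpect_mul_sub_le_of_union hε hμ (B := S ∩ T) (T := T \ S) (S \ T)
    ?_ ?_ ?_ ?_ ?_).trans ?_
  · exact disjoint_left.2 fun i => by simp +contextual
  · exact disjoint_left.2 fun i => by simp +contextual
  · exact disjoint_left.2 fun i => by simp +contextual
  · rwa [union_comm, sdiff_union_inter]
  · rwa [union_comm, inter_comm, sdiff_union_inter]
  · have h1 : (#(S \ T) : ℝ) ≤ k := by exact_mod_cast card_finset_fin_le _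
    have h2 : (#(T \ S) : ℝ) ≤ k := by exact_mod_cast card_finset_fin_le _
    rw [show (k : ℝ) ^ 2 * ε = k * (k * ε) by ring]
    gcongr

end Decorrelation

/-! ### The approximate Efron–Stein decomposition -/

section EfronStein

variable {k : ℕ} {V : Fin k → Type u} [∀ i, Fintype (V i)] {μ : (∀ i, V i) → ℝ} {ε : ℝ}

theorem efronStein_eq (S : Finset (Fin k)) (f : (∀ i, V i) → ℝ) :
    efronStein μ S f = ∑ T ∈ S.powerset, ((-1 : ℝ) ^ #(S \ T)) • avg μ T f := by
  ext x
  simp [efronStein]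

theorem efronStein_sum {ι : Type*} (s : Finset ι) (S : Finset (Fin k))
    (f : ι → (∀ i, V i) → ℝ) :
    efronStein μ S (∑ i ∈ s, f i) = ∑ i ∈ s, efronStein μ S (f i) := by
  simp only [efronStein_eq, avg_sum, smul_sum]
  exact sum_comm

theorem efronStein_sub (S : Finset (Fin k)) (f g : (∀ i, V i) → ℝ) :
    efronStein μ S (f - g) = efronStein μ S f - efronStein μ S g := by
  simp only [efronStein_eq, avg_sub, smul_sub, sum_sub_distrib]

theorem efronStein_congr {S : Finset (Fin k)} {f g : (∀ i, V i) → ℝ}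
    (h : ∀ x, μ x ≠ 0 → f x = g x) : efronStein μ S f = efronStein μ S g := by
  simp only [efronStein_eq, avg_congr h]

theorem dependsOn_efronStein (S : Finset (Fin k)) (f : (∀ i, V i) → ℝ) :
    DependsOn (efronStein μ S f) S := by
  intro x y h
  refine sum_congr rfl fun T hT => ?_
  rw [dependsOn_avg T f fun i hi => h i (mem_powerset.1 hT hi)]

theorem wExpect_smul_mul (w f g : (∀ i, V i) → ℝ) (c : ℝ) :
    wExpect w ((c • f) * g) = c * wExpect w (f * g) := by
  rw [smul_mul_assoc, wExpect_smul]

theorem wExpect_efronStein_mul (S : Finset (Fin k)) (f g : (∀ i, V i) → ℝ) :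
    wExpect μ (efronStein μ S f * g) =
      ∑ T ∈ S.powerset, (-1 : ℝ) ^ #(S \ T) * wExpect μ (avg μ T f * g) := by
  simp only [efronStein_eq, sum_mul, wExpect_sum, wExpect_smul_mul]

/-- The operators `f ↦ f^{=S}` are self-adjoint. -/
theorem wExpect_efronStein_mul_comm (hμ : ∀ x, 0 ≤ μ x) (S : Finset (Fin k))
    (f g : (∀ i, V i) → ℝ) :
    wExpect μ (efronStein μ S f * g) = wExpect μ (f * efronStein μ S g) := by
  rw [mul_comm f, wExpect_efronStein_mul, wExpect_efronStein_mul]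
  refine sum_congr rfl fun T _ => ?_
  rw [wExpect_avg_mul_comm hμ, mul_comm f]

theorem card_powerset_le (S : Finset (Fin k)) : (#S.powerset : ℝ) ≤ 2 ^ k := by
  rw [card_powerset]
  push_cast
  exact pow_le_pow_right₀ one_le_two (card_finset_fin_le S)

theorem card_finset_le (s : Finset (Finset (Fin k))) : (#s : ℝ) ≤ 2 ^ k := by
  refine le_trans ?_ (card_powerset_le univ)
  exact_mod_cast card_le_card fun S _ => by simp

theorem smul_sign_sq {α : Type*} (n : ℕ) (f : α → ℝ) : (((-1 : ℝ) ^ n) • f) ^ 2 = f ^ 2 := by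
  rw [smul_pow, ← pow_mul, mul_comm, pow_mul]
  simp

theorem wExpect_efronStein_sq_le_of_le (hμ : ∀ x, 0 ≤ μ x) (S : Finset (Fin k))
    (f : (∀ i, V i) → ℝ) {c : ℝ} (hc : 0 ≤ c)
    (h : ∀ T ⊆ S, wExpect μ (avg μ T f ^ 2) ≤ c) :
    wExpect μ (efronStein μ S f ^ 2) ≤ (2 ^ k) ^ 2 * c := by
  rw [efronStein_eq]
  refine wExpect_sum_sq_le_of_le hμ _ _ (card_powerset_le S) hc fun T hT => ?_
  rw [smul_sign_sq]
  exact h T (mem_powerset.1 hT)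

theorem wExpect_efronStein_sq_le (hμ : ∀ x, 0 ≤ μ x) (S : Finset (Fin k))
    (f : (∀ i, V i) → ℝ) :
    wExpect μ (efronStein μ S f ^ 2) ≤ (2 ^ k) ^ 2 * wExpect μ (f ^ 2) :=
  wExpect_efronStein_sq_le_of_le hμ S f (wExpect_sq_nonneg hμ f) fun T _ =>
    wExpect_avg_sq_le hμ T f

theorem abs_efronStein_le (hμ : ∀ x, 0 ≤ μ x) (S : Finset (Fin k)) {f : (∀ i, V i) → ℝ}
    {M : ℝ} (hM : 0 ≤ M) (h : ∀ x, μ x ≠ 0 → |f x| ≤ M) (x : ∀ i, V i) :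
    |efronStein μ S f x| ≤ 2 ^ k * M := by
  refine (abs_sum_le_sum_abs _ _).trans ?_
  calc ∑ T ∈ S.powerset, |(-1) ^ #(S \ T) * avg μ T f x| ≤ ∑ T ∈ S.powerset, M := by
        refine sum_le_sum fun T _ => ?_
        rw [abs_mul, abs_pow, abs_neg, abs_one, one_pow, one_mul]
        exact abs_avg_le hμ T hM h x
    _ = #S.powerset * M := by simp
    _ ≤ _ := by gcongr; exact card_powerset_le S

/-- The Efron–Stein decomposition: the functions `f^{=S}` add up to `f` on the support of `μ`. -/
theorem sum_efronStein_apply (hμ : ∀ x, 0 ≤ μ x) (f : (∀ i, V i) → ℝ) {x : ∀ i, V i}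
    (hx : μ x ≠ 0) : ∑ S, efronStein μ S f x = f x := by
  have h1 : ∀ T : Finset (Fin k), ∑ S : Finset (Fin k) with T ⊆ S, (-1 : ℝ) ^ #(S \ T) =
      if T = univ then 1 else 0 := by
    intro T
    have h2 : ∑ S : Finset (Fin k) with T ⊆ S, (-1 : ℝ) ^ #(S \ T) =
        ∑ R ∈ (univ \ T).powerset, (-1 : ℝ) ^ #R := by
      refine sum_nbij' (fun S => S \ T) (fun R => R ∪ T) ?_ ?_ ?_ ?_ ?_
      · exact fun S _ => mem_powerset.2 (sdiff_subset_sdiff (subset_univ S) subset_rfl)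
      · exact fun R _ => mem_filter.2 ⟨mem_univ _, subset_union_right⟩
      · exact fun S hS => sdiff_union_of_subset (mem_filter.1 hS).2
      · intro R hR
        rw [mem_powerset, subset_sdiff] at hR
        exact union_sdiff_cancel_right hR.2
      · exact fun _ _ => rfl
    have h3 := congrArg (Int.cast : ℤ → ℝ) (sum_powerset_neg_one_pow_card (x := univ \ T))
    push_cast at h3
    rw [h2, h3]
    simp [sdiff_eq_empty_iff_subset, univ_subset_iff]
  calc ∑ S, efronStein μ S f x
      = ∑ T, ∑ S : Finset (Fin k) with T ⊆ S, (-1 : ℝ) ^ #(S \ T) * avg μ T f x := by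
        refine sum_comm' fun S T => ?_
        simp
    _ = avg μ univ f x := by
        simp only [← sum_mul, h1]
        simp
    _ = f x := avg_apply_of_dependsOn hμ (by simpa using dependsOn_univ f) hx

theorem sum_powerset_sign_inter {S T : Finset (Fin k)} (h : ¬S ⊆ T) (F : Finset (Fin k) → ℝ) :
    ∑ U ∈ S.powerset, (-1 : ℝ) ^ #(S \ U) * F (T ∩ U) = 0 := by
  obtain ⟨i, hi, hiT⟩ := not_subset.1 h
  obtain ⟨S', hiS', rfl⟩ : ∃ S', i ∉ S' ∧ insert i S' = S :=
    ⟨S.erase i, notMem_erase i S, insert_erase hi⟩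
  rw [sum_powerset_insert hiS', ← sum_add_distrib]
  refine sum_eq_zero fun U hU => ?_
  have hiU : i ∉ U := fun h => hiS' (mem_powerset.1 hU h)
  have h1 : insert i S' \ insert i U = S' \ U := by
    ext j
    simp only [mem_sdiff, mem_insert]
    by_cases hj : j = i
    · subst hj; simp [hiS']
    · simp [hj]
  rw [inter_insert_of_notMem hiT, h1, insert_sdiff_of_notMem S' hiU,
    card_insert_of_notMem (by simp [hiS']), pow_succ]
  ring

/-- The constant in the statement that `A_T f^{=S}` is small in `L²` for `S ⊄ T`. -/
def decorr (k : ℕ) (ε : ℝ) : ℝ := 2 ^ k * (k ^ 2 * ε)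

theorem decorr_nonneg (hε : 0 ≤ ε) : 0 ≤ decorr k ε := by
  rw [decorr]
  positivity

theorem le_sq_mul_of_le_mul_sqrt {a b c : ℝ} (ha : 0 ≤ a) (hb : 0 ≤ b)
    (h : a ≤ c * (√a * √b)) : a ≤ c ^ 2 * b := by
  rcases ha.eq_or_lt with rfl | ha'
  · positivity
  · have h1 : 0 < √a := Real.sqrt_pos.2 ha'
    have h2 : √a ≤ c * √b := by
      refine le_of_mul_le_mul_left ?_ h1
      calc √a * √a = a := Real.mul_self_sqrt ha
        _ ≤ c * (√a * √b) := h
        _ = √a * (c * √b) := by ring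
    calc a = √a ^ 2 := (Real.sq_sqrt ha).symm
      _ ≤ (c * √b) ^ 2 := by gcongr
      _ = c ^ 2 * b := by rw [mul_pow, Real.sq_sqrt hb]

/-- If `S ⊄ T`, then `A_T f^{=S}` is small: up to errors, its terms `A_T A_U f` are `A_{T ∩ U} f`,
and these cancel in pairs. -/
theorem IsEpsProduct.wExpect_avg_efronStein_sq_le (h : IsEpsProduct ε μ) (hε : 0 ≤ ε)
    (hμ : ∀ x, 0 ≤ μ x) {S T : Finset (Fin k)} (hST : ¬S ⊆ T) (f : (∀ i, V i) → ℝ) :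
    wExpect μ (avg μ T (efronStein μ S f) ^ 2) ≤ decorr k ε ^ 2 * wExpect μ (f ^ 2) := by
  set u := avg μ T (efronStein μ S f) with hu
  have hu2 : wExpect μ (u ^ 2) = wExpect μ (efronStein μ S f * u) := by
    rw [sq, hu, wExpect_avg_mul_avg hμ]
  have hdiff : ∀ U, |wExpect μ (avg μ U f * u) - wExpect μ (avg μ (T ∩ U) f * u)| ≤
      k ^ 2 * ε * (√(wExpect μ (u ^ 2)) * √(wExpect μ (f ^ 2))) := by
    intro U
    have h1 := h.abs_wExpect_mul_sub_inter_le hε hμ (dependsOn_avg (μ := μ) T _ : DependsOn u T)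
      (dependsOn_avg (μ := μ) U f)
    rw [avg_avg hμ inter_subset_right, wExpect_avg_mul_avg hμ, mul_comm u, mul_comm u] at h1
    refine h1.trans ?_
    have := sqrt_wExpect_avg_sq_le hμ U f
    gcongr
  refine le_sq_mul_of_le_mul_sqrt (wExpect_sq_nonneg hμ u) (wExpect_sq_nonneg hμ f) ?_
  -- the sum with `T ∩ U` in place of `U` vanishes, so it can be subtracted
  have h0 := sum_powerset_sign_inter hST fun U => wExpect μ (avg μ U f * u)
  calc wExpect μ (u ^ 2) = ∑ U ∈ S.powerset, (-1 : ℝ) ^ #(S \ U) *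
        (wExpect μ (avg μ U f * u) - wExpect μ (avg μ (T ∩ U) f * u)) := by
        simp only [mul_sub, sum_sub_distrib]
        rw [h0, sub_zero, hu2, wExpect_efronStein_mul]
    _ ≤ ∑ U ∈ S.powerset, k ^ 2 * ε * (√(wExpect μ (u ^ 2)) * √(wExpect μ (f ^ 2))) := by
        refine sum_le_sum fun U _ => (le_abs_self _).trans ?_
        rw [abs_mul, abs_pow, abs_neg, abs_one, one_pow, one_mul]
        exact hdiff U
    _ = #S.powerset * (k ^ 2 * ε * (√(wExpect μ (u ^ 2)) * √(wExpect μ (f ^ 2)))) := by simp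
    _ ≤ 2 ^ k * (k ^ 2 * ε * (√(wExpect μ (u ^ 2)) * √(wExpect μ (f ^ 2)))) := by
        gcongr
        exact card_powerset_le S
    _ = _ := by rw [decorr]; ring

/-- The operators `f ↦ f^{=S}` are approximate projections. -/
theorem IsEpsProduct.abs_wExpect_mul_efronStein_sub_le (h : IsEpsProduct ε μ) (hε : 0 ≤ ε)
    (hμ : ∀ x, 0 ≤ μ x) (S : Finset (Fin k)) (g : (∀ i, V i) → ℝ) :
    |wExpect μ (efronStein μ S g ^ 2) - wExpect μ (g * efronStein μ S g)| ≤
      2 ^ k * (decorr k ε * wExpect μ (g ^ 2)) := by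
  have hη := decorr_nonneg (k := k) hε
  have hg := wExpect_sq_nonneg hμ g
  have hS : S ∈ S.powerset := mem_powerset_self S
  rw [sq, wExpect_efronStein_mul, ← add_sum_erase _ _ hS]
  rw [wExpect_avg_mul hμ (dependsOn_efronStein S g)]
  simp only [sdiff_self, bot_eq_empty, card_empty, pow_zero, one_mul, add_sub_cancel_left]
  calc _ ≤ ∑ T ∈ S.powerset.erase S, decorr k ε * wExpect μ (g ^ 2) := by
        refine (abs_sum_le_sum_abs _ _).trans (sum_le_sum fun T hT => ?_)
        rw [mem_erase, mem_powerset] at hT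
        rw [abs_mul, abs_pow, abs_neg, abs_one, one_pow, one_mul, wExpect_avg_mul_comm hμ]
        refine (abs_wExpect_mul_le hμ _ _).trans ?_
        have h1 := h.wExpect_avg_efronStein_sq_le hε hμ
          (fun hST => hT.1 (subset_antisymm hT.2 hST)) g
        calc _ ≤ √(wExpect μ (g ^ 2)) * √(decorr k ε ^ 2 * wExpect μ (g ^ 2)) := by gcongr
          _ = decorr k ε * (√(wExpect μ (g ^ 2)) * √(wExpect μ (g ^ 2))) := by
            rw [Real.sqrt_mul (sq_nonneg _), Real.sqrt_sq hη]
            ring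
          _ = _ := by rw [Real.mul_self_sqrt hg]
    _ = #(S.powerset.erase S) * (decorr k ε * wExpect μ (g ^ 2)) := by simp
    _ ≤ _ := by
        gcongr
        exact card_finset_le _

/-- An approximate Parseval inequality. -/
theorem IsEpsProduct.wExpect_sq_le_sum (h : IsEpsProduct ε μ) (hε : 0 ≤ ε)
    (hμ : ∀ x, 0 ≤ μ x) (g : (∀ i, V i) → ℝ) :
    wExpect μ (g ^ 2) ≤ ∑ S, wExpect μ (efronStein μ S g ^ 2) +
      (2 ^ k) ^ 2 * (decorr k ε * wExpect μ (g ^ 2)) := by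
  have hη := decorr_nonneg (k := k) hε
  have hg := wExpect_sq_nonneg hμ g
  have h1 : wExpect μ (g ^ 2) = ∑ S, wExpect μ (g * efronStein μ S g) := by
    rw [← wExpect_sum, ← mul_sum]
    refine wExpect_congr fun x hx => ?_
    rw [Pi.pow_apply, Pi.mul_apply, Finset.sum_apply, sum_efronStein_apply hμ g hx, sq]
  have h2 : ∑ S, wExpect μ (g * efronStein μ S g) ≤ ∑ S, (wExpect μ (efronStein μ S g ^ 2) +
      2 ^ k * (decorr k ε * wExpect μ (g ^ 2))) := by
    refine sum_le_sum fun S _ => ?_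
    have := (abs_le.1 (h.abs_wExpect_mul_efronStein_sub_le hε hμ S g)).1
    linarith
  rw [sum_add_distrib, sum_const, nsmul_eq_mul] at h2
  have h3 : ((#(univ : Finset (Finset (Fin k))) : ℕ) : ℝ) *
      (2 ^ k * (decorr k ε * wExpect μ (g ^ 2))) ≤
      2 ^ k * (2 ^ k * (decorr k ε * wExpect μ (g ^ 2))) := by
    gcongr
    exact card_finset_le _
  rw [h1] at h3 ⊢
  rw [h1] at h2
  linarith

/-- `f^{=S}` is almost bounded by `A_S f` in `L²`. -/
theorem IsEpsProduct.wExpect_efronStein_sq_le_avg (h : IsEpsProduct ε μ) (hε : 0 ≤ ε)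
    (hμ : ∀ x, 0 ≤ μ x) (S : Finset (Fin k)) (g : (∀ i, V i) → ℝ) :
    wExpect μ (efronStein μ S g ^ 2) ≤ wExpect μ (avg μ S g ^ 2) +
      2 * (2 ^ k * (decorr k ε * wExpect μ (g ^ 2))) := by
  have h1 := (abs_le.1 (h.abs_wExpect_mul_efronStein_sub_le hε hμ S g)).2
  rw [← wExpect_avg_mul hμ (dependsOn_efronStein S g)] at h1
  have h2 : 2 * wExpect μ (avg μ S g * efronStein μ S g) ≤
      wExpect μ (avg μ S g ^ 2) + wExpect μ (efronStein μ S g ^ 2) := by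
    rw [← wExpect_smul, ← wExpect_add]
    refine wExpect_mono hμ fun x _ => ?_
    simp only [Pi.smul_apply, Pi.mul_apply, Pi.add_apply, Pi.pow_apply, smul_eq_mul]
    linarith [two_mul_le_add_sq (avg μ S g x) (efronStein μ S g x)]
  linarith

theorem wExpect_mul_sq_le (hμ : ∀ x, 0 ≤ μ x) (f : (∀ i, V i) → ℝ) {u : (∀ i, V i) → ℝ} {c : ℝ}
    (hu : ∀ x, |u x| ≤ c) : wExpect μ ((u * f) ^ 2) ≤ c ^ 2 * wExpect μ (f ^ 2) := by
  rw [← wExpect_smul]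
  refine wExpect_mono hμ fun x _ => ?_
  simp only [Pi.pow_apply, Pi.mul_apply, Pi.smul_apply, smul_eq_mul, mul_pow]
  have := sq_le_sq' (abs_le.1 (hu x)).1 (abs_le.1 (hu x)).2
  gcongr

/-- If `f^{=T}` is multiplied by a bounded function of coordinates in `T'`, then averaging over a
coordinate in `T` but not in `T'` still makes it small. -/
theorem IsEpsProduct.wExpect_avg_mul_efronStein_sq_le (h : IsEpsProduct ε μ) (hε : 0 ≤ ε)
    (hμ : ∀ x, 0 ≤ μ x) {S T T' : Finset (Fin k)} (hT : ¬T ⊆ S ∪ T') (f : (∀ i, V i) → ℝ)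
    {u : (∀ i, V i) → ℝ} (hu : DependsOn u T') {c : ℝ} (hc : ∀ x, |u x| ≤ c) :
    wExpect μ (avg μ S (u * efronStein μ T f) ^ 2) ≤
      decorr k ε ^ 2 * c ^ 2 * wExpect μ (f ^ 2) := by
  rw [← avg_avg hμ subset_union_left,
    avg_mul_left (hu.mono (by exact_mod_cast subset_union_right))]
  refine (wExpect_avg_sq_le hμ S _).trans ((wExpect_mul_sq_le hμ _ hc).trans ?_)
  calc _ ≤ c ^ 2 * (decorr k ε ^ 2 * wExpect μ (f ^ 2)) := by
        gcongr
        exact h.wExpect_avg_efronStein_sq_le hε hμ hT f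
    _ = _ := by ring

theorem IsEpsProduct.wExpect_efronStein_mul_efronStein_sq_le (h : IsEpsProduct ε μ) (hε : 0 ≤ ε)
    (hμ : ∀ x, 0 ≤ μ x) {S T T' : Finset (Fin k)} (hT : ¬T ⊆ S ∪ T') (f : (∀ i, V i) → ℝ)
    {u : (∀ i, V i) → ℝ} (hu : DependsOn u T') {c : ℝ} (hc : ∀ x, |u x| ≤ c) :
    wExpect μ (efronStein μ S (u * efronStein μ T f) ^ 2) ≤
      (2 ^ k) ^ 2 * (decorr k ε ^ 2 * c ^ 2 * wExpect μ (f ^ 2)) := by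
  have hf := wExpect_sq_nonneg hμ f
  refine wExpect_efronStein_sq_le_of_le hμ S _ (by positivity) fun R hR => ?_
  exact h.wExpect_avg_mul_efronStein_sq_le hε hμ
    (fun hT' => hT (hT'.trans (union_subset_union_left hR))) f hu hc

/-- If `h` is a function of the coordinates in `T` and `S ⊄ T`, then `h^{=S}` is small. -/
theorem IsEpsProduct.wExpect_efronStein_sq_le_of_dependsOn (h : IsEpsProduct ε μ) (hε : 0 ≤ ε)
    (hμ : ∀ x, 0 ≤ μ x) {S T : Finset (Fin k)} (hST : ¬S ⊆ T) {u : (∀ i, V i) → ℝ}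
    (hu : DependsOn u T) :
    wExpect μ (efronStein μ S u ^ 2) ≤ decorr k ε ^ 2 * wExpect μ (u ^ 2) := by
  have hη := decorr_nonneg (k := k) hε
  refine le_sq_mul_of_le_mul_sqrt (wExpect_sq_nonneg hμ _) (wExpect_sq_nonneg hμ u) ?_
  have h1 := h.wExpect_avg_efronStein_sq_le hε hμ hST (efronStein μ S u)
  calc wExpect μ (efronStein μ S u ^ 2)
      = wExpect μ (avg μ T (efronStein μ S (efronStein μ S u)) * u) := by
        rw [wExpect_avg_mul hμ hu, wExpect_efronStein_mul_comm hμ, sq,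
          wExpect_efronStein_mul_comm hμ, mul_comm, wExpect_efronStein_mul_comm hμ]
    _ ≤ √(decorr k ε ^ 2 * wExpect μ (efronStein μ S u ^ 2)) * √(wExpect μ (u ^ 2)) := by
        refine (le_abs_self _).trans ((abs_wExpect_mul_le hμ _ _).trans ?_)
        gcongr
    _ = _ := by
        rw [Real.sqrt_mul (sq_nonneg _), Real.sqrt_sq hη]
        ring

end EfronStein

/-! ### Sums over pairs of sets -/

section Combinatorics

variable {k : ℕ}

theorem sum_powerset_three_pow (S : Finset (Fin k)) :
    ∑ A ∈ S.powerset, (3 : ℝ) ^ #A = 4 ^ #S := by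
  have := sum_pow_mul_eq_add_pow (3 : ℝ) 1 S
  norm_num at this
  exact this

theorem card_union_eq_le (S : Finset (Fin k)) :
    (#{p : Finset (Fin k) × Finset (Fin k) | p.1 ∪ p.2 = S} : ℝ) ≤ 3 ^ #S := by
  have h1 : #{p : Finset (Fin k) × Finset (Fin k) | p.1 ∪ p.2 = S} ≤
      #(S.powerset.sigma fun A => A.powerset) := by
    refine card_le_card_of_injOn (fun p => ⟨p.1, p.1 ∩ p.2⟩) ?_ ?_
    · intro p hp
      have hp' : p.1 ∪ p.2 = S := by simpa using hp
      rw [← hp']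
      exact mem_sigma.2 ⟨mem_powerset.2 subset_union_left, mem_powerset.2 inter_subset_left⟩
    · intro p hp q hq hpq
      have hp' : p.1 ∪ p.2 = S := by simpa using hp
      have hq' : q.1 ∪ q.2 = S := by simpa using hq
      have h1 : p.1 = q.1 := congrArg Sigma.fst hpq
      have h2 : p.1 ∩ p.2 = q.1 ∩ q.2 := by
        have h3 := (Sigma.mk.inj hpq).2
        exact eq_of_heq h3
      refine Prod.ext h1 ?_
      ext i
      have h4 : i ∈ p.1 ∪ p.2 ↔ i ∈ q.1 ∪ q.2 := by rw [hp', hq']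
      have h5 : i ∈ p.1 ∩ p.2 ↔ i ∈ q.1 ∩ q.2 := by rw [h2]
      rw [h1] at h4 h5
      simp only [mem_union, mem_inter] at h4 h5
      tauto
  have h2 := sum_pow_mul_eq_add_pow (2 : ℕ) 1 S
  norm_num at h2
  rw [card_sigma] at h1
  simp only [card_powerset, h2] at h1
  exact_mod_cast h1

theorem sum_Icc_three_pow (R T : Finset (Fin k)) (hRT : R ⊆ T) :
    ∑ A : Finset (Fin k) with R ⊆ A ∧ A ⊆ T, (3 : ℝ) ^ #(A \ R) = 4 ^ #(T \ R) := by
  rw [← sum_powerset_three_pow]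
  refine sum_nbij' (fun A => A \ R) (fun A => A ∪ R) ?_ ?_ ?_ ?_ ?_
  · intro A hA
    exact mem_powerset.2 (sdiff_subset_sdiff (mem_filter.1 hA).2.2 subset_rfl)
  · intro A hA
    rw [mem_powerset] at hA
    exact mem_filter.2 ⟨mem_univ _, subset_union_right, union_subset (hA.trans sdiff_subset) hRT⟩
  · exact fun A hA => sdiff_union_of_subset (mem_filter.1 hA).2.1
  · intro A hA
    rw [mem_powerset, subset_sdiff] at hA
    exact union_sdiff_cancel_right hA.2
  · exact fun _ _ => rfl

/-- The sets `A ∪ U` with `U` disjoint from `S ⊇ A` are distinct supersets of `A`. -/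
theorem sum_union_le_sum_superset {S A : Finset (Fin k)} (hA : A ⊆ S) (d : ℕ)
    {φ : Finset (Fin k) → ℝ} (hφ : ∀ T, 0 ≤ φ T) :
    ∑ U ∈ Sᶜ.powerset with #(A ∪ U) ≤ d, φ (A ∪ U) ≤
      ∑ T : Finset (Fin k) with A ⊆ T ∧ #T ≤ d, φ T := by
  have hinj : Set.InjOn (fun U => A ∪ U) (Sᶜ.powerset.filter fun U => #(A ∪ U) ≤ d) := by
    intro U hU W hW hUW
    have h1 : ∀ X ∈ (Sᶜ.powerset.filter fun U => #(A ∪ U) ≤ d), (A ∪ X) \ A = X := by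
      intro X hX
      refine union_sdiff_cancel_left ?_
      exact disjoint_of_subset_left hA
        (disjoint_of_subset_right (mem_powerset.1 (mem_filter.1 hX).1) disjoint_compl_right)
    rw [← h1 U hU, ← h1 W hW]
    exact congrArg (· \ A) hUW
  rw [← sum_image (f := φ) hinj]
  refine sum_le_sum_of_subset_of_nonneg ?_ fun T _ _ => hφ T
  intro T hT
  obtain ⟨U, hU, rfl⟩ := mem_image.1 hT
  exact mem_filter.2 ⟨mem_univ _, subset_union_left, (mem_filter.1 hU).2⟩

/-- The pairs `(T, T')` that can contribute to the part of a product at `S` correspond to a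
decomposition `S = A ∪ B` and a set `U` outside `S`, through `T = A ∪ U` and `T' = B ∪ U`. -/
theorem sum_good_pairs {β : Type*} [AddCommMonoid β] (d : ℕ) (S : Finset (Fin k))
    (φ : Finset (Fin k) → Finset (Fin k) → β) :
    ∑ p : Finset (Fin k) × Finset (Fin k) with (#p.1 ≤ d ∧ #p.2 ≤ d) ∧
        p.1 ⊆ S ∪ p.2 ∧ p.2 ⊆ S ∪ p.1 ∧ S ⊆ p.1 ∪ p.2, φ p.1 p.2 =
      ∑ q : Finset (Fin k) × Finset (Fin k) with q.1 ∪ q.2 = S,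
        ∑ U ∈ Sᶜ.powerset with #(q.1 ∪ U) ≤ d ∧ #(q.2 ∪ U) ≤ d, φ (q.1 ∪ U) (q.2 ∪ U) := by
  rw [sum_sigma' (univ.filter fun q : Finset (Fin k) × Finset (Fin k) => q.1 ∪ q.2 = S)
    (fun q => Sᶜ.powerset.filter fun U => #(q.1 ∪ U) ≤ d ∧ #(q.2 ∪ U) ≤ d)]
  have e1 : ∀ p : Finset (Fin k) × Finset (Fin k), p.1 ⊆ S ∪ p.2 → p.2 ⊆ S ∪ p.1 →
      (p.1 ∩ S) ∪ (p.1 \ S) = p.1 ∧ (p.2 ∩ S) ∪ (p.1 \ S) = p.2 := by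
    intro p h1 h2
    constructor
    · rw [union_comm, sdiff_union_inter]
    · ext i
      have h1' := @h1 i
      have h2' := @h2 i
      simp only [mem_union, mem_inter, mem_sdiff] at h1' h2' ⊢
      tauto
  have e2 : ∀ A B U : Finset (Fin k), A ∪ B = S → U ⊆ Sᶜ →
      ((A ∪ U) ∩ S = A ∧ (B ∪ U) ∩ S = B) ∧ (A ∪ U) \ S = U := by
    rintro A B U rfl hU
    refine ⟨⟨?_, ?_⟩, ?_⟩ <;>
    · ext i
      have h1 := @hU i
      simp only [mem_union, mem_inter, mem_sdiff, mem_compl] at h1 ⊢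
      tauto
  refine sum_bij' (fun p _ => ⟨(p.1 ∩ S, p.2 ∩ S), p.1 \ S⟩)
    (fun x _ => (x.1.1 ∪ x.2, x.1.2 ∪ x.2)) ?_ ?_ ?_ ?_ ?_
  · intro p hp
    obtain ⟨-, hd, h1, h2, h3⟩ := mem_filter.1 hp
    obtain ⟨h4, h5⟩ := e1 p h1 h2
    simp only [mem_sigma, mem_filter, mem_univ, true_and, mem_powerset]
    rw [h4, h5]
    refine ⟨?_, ?_, hd⟩
    · rw [← union_inter_distrib_right]
      exact inter_eq_right.2 h3
    · intro i
      simp +contextual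
  · rintro ⟨⟨A, B⟩, U⟩ hx
    simp only [mem_sigma, mem_filter, mem_univ, true_and, mem_powerset] at hx
    obtain ⟨rfl, hU, hd⟩ := hx
    refine mem_filter.2 ⟨mem_univ _, hd, ?_, ?_, ?_⟩ <;>
    · intro i
      simp only [mem_union]
      tauto
  · intro p hp
    obtain ⟨-, hd, h1, h2, h3⟩ := mem_filter.1 hp
    obtain ⟨h4, h5⟩ := e1 p h1 h2
    exact Prod.ext h4 h5
  · rintro ⟨⟨A, B⟩, U⟩ hx
    simp only [mem_sigma, mem_filter, mem_univ, true_and, mem_powerset] at hx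
    obtain ⟨hS, hU, hd⟩ := hx
    obtain ⟨⟨h1, h2⟩, h3⟩ := e2 A B U hS hU
    simp only [h1, h2, h3]
  · intro p hp
    obtain ⟨-, hd, h1, h2, h3⟩ := mem_filter.1 hp
    obtain ⟨h4, h5⟩ := e1 p h1 h2
    simp only [h4, h5]

/-- Pairs `(A, B)` are sorted by their intersection `R`, whose only property that is kept is that
it is contained in both sets. -/
theorem sum_inter_le {φ : Finset (Fin k) → Finset (Fin k) → Finset (Fin k) → ℝ}
    (hφ : ∀ R A B, 0 ≤ φ R A B) :
    ∑ p : Finset (Fin k) × Finset (Fin k), φ (p.1 ∩ p.2) p.1 p.2 ≤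
      ∑ R, ∑ A with R ⊆ A, ∑ B with R ⊆ B, φ R A B := by
  rw [← sum_fiberwise (s := univ)
    (g := fun p : Finset (Fin k) × Finset (Fin k) => p.1 ∩ p.2)]
  refine sum_le_sum fun R _ => ?_
  rw [← sum_product']
  calc _ = ∑ p : Finset (Fin k) × Finset (Fin k) with p.1 ∩ p.2 = R, φ R p.1 p.2 :=
        sum_congr rfl fun p hp => by rw [(mem_filter.1 hp).2]
    _ ≤ _ := by
        refine sum_le_sum_of_subset_of_nonneg ?_ fun p _ _ => hφ R p.1 p.2
        intro p hp
        have h1 := (mem_filter.1 hp).2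
        simp only [mem_product, mem_filter, mem_univ, true_and, ← h1]
        exact ⟨inter_subset_left, inter_subset_right⟩

end Combinatorics

/-! ### Products of two parts of the decomposition -/

section Quartic

variable {k : ℕ} {V : Fin k → Type u} [∀ i, Fintype (V i)] {μ : (∀ i, V i) → ℝ} {ε : ℝ}

theorem lowDegree_eq (d : ℕ) (f : (∀ i, V i) → ℝ) :
    lowDegree μ d f = ∑ S : Finset (Fin k) with #S ≤ d, efronStein μ S f := by
  ext x
  simp [lowDegree]

theorem lowDegreeLaplacian_eq (d : ℕ) (S : Finset (Fin k)) (f : (∀ i, V i) → ℝ) :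
    lowDegreeLaplacian μ d S f =
      ∑ T : Finset (Fin k) with S ⊆ T ∧ #T ≤ d, efronStein μ T f := by
  ext x
  simp [lowDegreeLaplacian]

theorem lowDegreeInfluence_restrict (hμ : ∀ x, 0 ≤ μ x) (d : ℕ) (S : Finset (Fin k))
    (f : (∀ i, V i) → ℝ) (x : ∀ i, V i) :
    lowDegreeInfluence μ d S f (S.restrict x) = avg μ S (lowDegreeLaplacian μ d S f ^ 2) x :=
  lpNorm_two_sq (link_nonneg hμ S _) _

/-- The size of the error terms, a multiple of `ε ^ 2 * ‖f‖₂ ^ 2 * ‖f‖_∞ ^ 2`. -/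
def errTerm (μ : (∀ i, V i) → ℝ) (ε : ℝ) (f : (∀ i, V i) → ℝ) : ℝ :=
  (2 ^ k) ^ 4 * (decorr k ε ^ 2 * (supNorm μ f ^ 2 * wExpect μ (f ^ 2)))

theorem errTerm_nonneg (hμ : ∀ x, 0 ≤ μ x) (ε : ℝ) (f : (∀ i, V i) → ℝ) :
    0 ≤ errTerm μ ε f := by
  have := wExpect_sq_nonneg hμ f
  rw [errTerm]
  positivity

theorem one_le_two_pow_real (k : ℕ) : (1 : ℝ) ≤ 2 ^ k := one_le_pow₀ one_le_two

theorem abs_efronStein_le_supNorm (hμ : ∀ x, 0 ≤ μ x) (S : Finset (Fin k))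
    (f : (∀ i, V i) → ℝ) (x : ∀ i, V i) : |efronStein μ S f x| ≤ 2 ^ k * supNorm μ f :=
  abs_efronStein_le hμ S (supNorm_nonneg f) (fun _ hx => abs_le_supNorm f hx) x

theorem IsEpsProduct.wExpect_efronStein_mul_le_errTerm (h : IsEpsProduct ε μ) (hε : 0 ≤ ε)
    (hμ : ∀ x, 0 ≤ μ x) (f : (∀ i, V i) → ℝ) {S T T' : Finset (Fin k)}
    (hbad : ¬(T ⊆ S ∪ T' ∧ T' ⊆ S ∪ T ∧ S ⊆ T ∪ T')) :
    wExpect μ (efronStein μ S (efronStein μ T f * efronStein μ T' f) ^ 2) ≤ errTerm μ ε f := by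
  by_cases h1 : T ⊆ S ∪ T'
  · by_cases h2 : T' ⊆ S ∪ T
    · have h3 : ¬S ⊆ T ∪ T' := fun h3 => hbad ⟨h1, h2, h3⟩
      have hdep : DependsOn (efronStein μ T f * efronStein μ T' f) (T ∪ T' : Finset (Fin k)) := by
        intro x y hxy
        rw [Pi.mul_apply, Pi.mul_apply,
          dependsOn_efronStein T f fun i hi => hxy i (by exact_mod_cast subset_union_left hi),
          dependsOn_efronStein T' f fun i hi => hxy i (by exact_mod_cast subset_union_right hi)]
      refine (h.wExpect_efronStein_sq_le_of_dependsOn hε hμ h3 hdep).trans ?_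
      calc _ ≤ decorr k ε ^ 2 * ((2 ^ k * supNorm μ f) ^ 2 *
            ((2 ^ k) ^ 2 * wExpect μ (f ^ 2))) := by
            gcongr
            refine (wExpect_mul_sq_le hμ _ (abs_efronStein_le_supNorm hμ T f)).trans ?_
            gcongr
            exact wExpect_efronStein_sq_le hμ T' f
        _ = _ := by rw [errTerm]; ring
    · refine (h.wExpect_efronStein_mul_efronStein_sq_le hε hμ h2 f (dependsOn_efronStein T f)
        (abs_efronStein_le_supNorm hμ T f)).trans (le_of_eq ?_)
      rw [errTerm]
      ring
  · rw [mul_comm]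
    refine (h.wExpect_efronStein_mul_efronStein_sq_le hε hμ h1 f (dependsOn_efronStein T' f)
      (abs_efronStein_le_supNorm hμ T' f)).trans (le_of_eq ?_)
    rw [errTerm]
    ring

theorem IsEpsProduct.wExpect_avg_mul_le_errTerm (h : IsEpsProduct ε μ) (hε : 0 ≤ ε)
    (hμ : ∀ x, 0 ≤ μ x) (f : (∀ i, V i) → ℝ) {R T T' : Finset (Fin k)} (hR : R ⊆ T)
    (hR' : R ⊆ T') (hne : T ≠ T') :
    wExpect μ (avg μ R (efronStein μ T f * efronStein μ T' f) ^ 2) ≤ errTerm μ ε f := by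
  have hf := wExpect_sq_nonneg hμ f
  have key : ∀ T T' : Finset (Fin k), R ⊆ T → ¬T' ⊆ T →
      wExpect μ (avg μ R (efronStein μ T f * efronStein μ T' f) ^ 2) ≤ errTerm μ ε f := by
    intro T T' hR hT
    refine (h.wExpect_avg_mul_efronStein_sq_le hε hμ (by rwa [union_eq_right.2 hR]) f
      (dependsOn_efronStein T f) (abs_efronStein_le_supNorm hμ T f)).trans ?_
    calc _ = (2 ^ k) ^ 2 * (decorr k ε ^ 2 * (supNorm μ f ^ 2 * wExpect μ (f ^ 2))) := by ring
      _ ≤ errTerm μ ε f := by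
        rw [errTerm]
        gcongr
        · exact one_le_two_pow_real k
        · norm_num
  by_cases hT : T' ⊆ T
  · rw [mul_comm]
    exact key T' T hR' fun hT' => hne (subset_antisymm hT' hT)
  · exact key T T' hR hT

/-- The main part of `((f^{≤d})²)^{=A ∪ B}` that belongs to the pair `(A, B)`: the products of
`f^{=A ∪ U}` and `f^{=B ∪ U}` with `U` outside `A ∪ B`. -/
def pairTerm (μ : (∀ i, V i) → ℝ) (d : ℕ) (A B : Finset (Fin k)) (f : (∀ i, V i) → ℝ) :
    (∀ i, V i) → ℝ :=
  ∑ U ∈ (A ∪ B)ᶜ.powerset with #(A ∪ U) ≤ d ∧ #(B ∪ U) ≤ d,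
    efronStein μ (A ∪ U) f * efronStein μ (B ∪ U) f

/-- The sum of the squares of the functions `f^{=A ∪ U}` of degree at most `d`, with `U` outside
`S`. -/
def blockSq (μ : (∀ i, V i) → ℝ) (d : ℕ) (S A : Finset (Fin k)) (f : (∀ i, V i) → ℝ) :
    (∀ i, V i) → ℝ :=
  ∑ U ∈ Sᶜ.powerset with #(A ∪ U) ≤ d, efronStein μ (A ∪ U) f ^ 2

/-- The sum of the fourth moments of the parts of `f` of degree at most `d`. -/
def fourthMoments (μ : (∀ i, V i) → ℝ) (d : ℕ) (f : (∀ i, V i) → ℝ) : ℝ :=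
  ∑ T : Finset (Fin k) with #T ≤ d, wExpect μ (efronStein μ T f ^ 4)

theorem wExpect_pow_four_nonneg (hμ : ∀ x, 0 ≤ μ x) (f : (∀ i, V i) → ℝ) :
    0 ≤ wExpect μ (f ^ 4) :=
  wExpect_nonneg hμ fun x => by simp only [Pi.pow_apply]; positivity

theorem fourthMoments_nonneg (hμ : ∀ x, 0 ≤ μ x) (d : ℕ) (f : (∀ i, V i) → ℝ) :
    0 ≤ fourthMoments μ d f :=
  sum_nonneg fun _ _ => wExpect_pow_four_nonneg hμ _

theorem blockSq_nonneg (d : ℕ) (S A : Finset (Fin k)) (f : (∀ i, V i) → ℝ) (x : ∀ i, V i) :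
    0 ≤ blockSq μ d S A f x := by
  rw [blockSq, Finset.sum_apply]
  exact sum_nonneg fun _ _ => sq_nonneg _

theorem dependsOn_blockSq (d : ℕ) (S A : Finset (Fin k)) (f : (∀ i, V i) → ℝ) :
    DependsOn (blockSq μ d S A f) (A ∪ Sᶜ : Finset (Fin k)) := by
  intro x y hxy
  simp only [blockSq, Finset.sum_apply, Pi.pow_apply]
  refine sum_congr rfl fun U hU => ?_
  rw [dependsOn_efronStein (A ∪ U) f fun i hi => hxy i ?_]
  exact_mod_cast union_subset_union_right (mem_powerset.1 (mem_filter.1 hU).1) hi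

theorem wExpect_blockSq_sq_le (hμ : ∀ x, 0 ≤ μ x) (d : ℕ) {S A : Finset (Fin k)} (hA : A ⊆ S)
    (f : (∀ i, V i) → ℝ) :
    wExpect μ (blockSq μ d S A f ^ 2) ≤ 2 ^ k * fourthMoments μ d f := by
  rw [blockSq]
  refine (wExpect_sum_sq_le hμ _ _).trans ?_
  simp only [← pow_mul, show 2 * 2 = 4 from rfl]
  have h1 := sum_union_le_sum_superset hA d (φ := fun T => wExpect μ (efronStein μ T f ^ 4))
    fun T => wExpect_pow_four_nonneg hμ _
  have h2 : ∑ T : Finset (Fin k) with A ⊆ T ∧ #T ≤ d, wExpect μ (efronStein μ T f ^ 4) ≤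
      fourthMoments μ d f :=
    sum_le_sum_of_subset_of_nonneg (fun T hT => by simp_all) fun _ _ _ =>
      wExpect_pow_four_nonneg hμ _
  have h3 := fourthMoments_nonneg hμ d f
  refine mul_le_mul (card_finset_le _) (h1.trans h2) ?_ (by positivity)
  exact sum_nonneg fun _ _ => wExpect_pow_four_nonneg hμ _

theorem pairTerm_sq_le (d : ℕ) (A B : Finset (Fin k)) (f : (∀ i, V i) → ℝ) (x : ∀ i, V i) :
    pairTerm μ d A B f x ^ 2 ≤ blockSq μ d (A ∪ B) A f x * blockSq μ d (A ∪ B) B f x := by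
  simp only [pairTerm, blockSq, Finset.sum_apply, Pi.mul_apply, Pi.pow_apply]
  refine (sum_mul_sq_le_sq_mul_sq _ _ _).trans ?_
  refine mul_le_mul ?_ ?_ (sum_nonneg fun _ _ => sq_nonneg _)
    (sum_nonneg fun _ _ => sq_nonneg _) <;>
  refine sum_le_sum_of_subset_of_nonneg (fun U hU => ?_) fun _ _ _ => sq_nonneg _
  · exact mem_filter.2 ⟨(mem_filter.1 hU).1, (mem_filter.1 hU).2.1⟩
  · exact mem_filter.2 ⟨(mem_filter.1 hU).1, (mem_filter.1 hU).2.2⟩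

/-- The estimate for one pair `(A, B)`: by Cauchy–Schwarz over `U` and in the links of `A ∪ B`,
followed by the approximate independence, given the coordinates in `A ∩ B`, of the resulting
functions of the coordinates in `A` and in `B`. -/
theorem IsEpsProduct.wExpect_efronStein_pairTerm_le (h : IsEpsProduct ε μ) (hε : 0 ≤ ε)
    (hμ : ∀ x, 0 ≤ μ x) (d : ℕ) (A B : Finset (Fin k)) (f : (∀ i, V i) → ℝ) :
    wExpect μ (efronStein μ (A ∪ B) (pairTerm μ d A B f) ^ 2) ≤
      wExpect μ (avg μ (A ∩ B) (blockSq μ d (A ∪ B) A f) *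
        avg μ (A ∩ B) (blockSq μ d (A ∪ B) B f)) +
      4 * (2 ^ k) ^ 2 * (decorr k ε * fourthMoments μ d f) := by
  set S := A ∪ B with hS
  set H := blockSq μ d S A f with hH
  set H' := blockSq μ d S B f with hH'
  set Q := fourthMoments μ d f
  have hη := decorr_nonneg (k := k) hε
  have hQ : 0 ≤ Q := fourthMoments_nonneg hμ d f
  have hA : A ⊆ S := subset_union_left
  have hB : B ⊆ S := subset_union_right
  have hH2 : wExpect μ (H ^ 2) ≤ 2 ^ k * Q := wExpect_blockSq_sq_le hμ d hA f
  have hH2' : wExpect μ (H' ^ 2) ≤ 2 ^ k * Q := wExpect_blockSq_sq_le hμ d hB f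
  have hprod : √(wExpect μ (H ^ 2)) * √(wExpect μ (H' ^ 2)) ≤ 2 ^ k * Q := by
    calc _ ≤ √(2 ^ k * Q) * √(2 ^ k * Q) := by gcongr
      _ = _ := Real.mul_self_sqrt (by positivity)
  have hG2 : wExpect μ (pairTerm μ d A B f ^ 2) ≤ 2 ^ k * Q := by
    refine le_trans ?_ ((le_abs_self _).trans ((abs_wExpect_mul_le hμ H H').trans hprod))
    exact wExpect_mono hμ fun x _ => pairTerm_sq_le d A B f x
  have hAG : wExpect μ (avg μ S (pairTerm μ d A B f) ^ 2) ≤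
      wExpect μ (avg μ S H * avg μ S H') := by
    refine wExpect_mono hμ fun x _ => ?_
    exact sq_wExpect_le_mul (link_nonneg hμ S _) (blockSq_nonneg d S A f)
      (blockSq_nonneg d S B f) (pairTerm_sq_le d A B f)
  -- replace `A_S H` by `A_A H`, then `A_B H'` by `A_{A ∩ B} H'`
  have hdA : (A ∪ Sᶜ) ∩ S = A := by
    ext i
    have := @hA i
    simp only [mem_inter, mem_union, mem_compl]
    tauto
  have hdB : A ∩ (B ∪ Sᶜ) = A ∩ B := by
    ext i
    have := @hA i
    simp only [mem_inter, mem_union, mem_compl]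
    tauto
  have h1 := h.abs_wExpect_mul_sub_inter_le hε hμ (dependsOn_blockSq (μ := μ) d S A f)
    (dependsOn_avg (μ := μ) S H')
  rw [hdA, avg_avg hμ hA] at h1
  have h2 := h.abs_wExpect_mul_sub_inter_le hε hμ (dependsOn_avg (μ := μ) A H)
    (dependsOn_blockSq (μ := μ) d S B f)
  rw [hdB, avg_avg hμ inter_subset_left] at h2
  have hmid : wExpect μ (avg μ A H * avg μ A H') = wExpect μ (avg μ A H * H') := by
    rw [mul_comm, wExpect_avg_mul_avg hμ, mul_comm]
  rw [← wExpect_avg_mul_avg hμ, ← hH, hmid] at h1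
  rw [← hH'] at h2
  have h3 : (k : ℝ) ^ 2 * ε * (√(wExpect μ (H ^ 2)) * √(wExpect μ (avg μ S H' ^ 2))) ≤
      decorr k ε * Q := by
    calc _ ≤ (k : ℝ) ^ 2 * ε * (√(wExpect μ (H ^ 2)) * √(wExpect μ (H' ^ 2))) := by
          have := sqrt_wExpect_avg_sq_le hμ S H'
          gcongr
      _ ≤ (k : ℝ) ^ 2 * ε * (2 ^ k * Q) := by gcongr
      _ = _ := by rw [decorr]; ring
  have h4 : (k : ℝ) ^ 2 * ε * (√(wExpect μ (avg μ A H ^ 2)) * √(wExpect μ (H' ^ 2))) ≤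
      decorr k ε * Q := by
    calc _ ≤ (k : ℝ) ^ 2 * ε * (√(wExpect μ (H ^ 2)) * √(wExpect μ (H' ^ 2))) := by
          have := sqrt_wExpect_avg_sq_le hμ A H
          gcongr
      _ ≤ (k : ℝ) ^ 2 * ε * (2 ^ k * Q) := by gcongr
      _ = _ := by rw [decorr]; ring
  have h5 := (abs_le.1 (h1.trans h3)).2
  have h6 := (abs_le.1 (h2.trans h4)).2
  have h7 := h.wExpect_efronStein_sq_le_avg hε hμ S (pairTerm μ d A B f)
  have h8 : 2 * (2 ^ k * (decorr k ε * wExpect μ (pairTerm μ d A B f ^ 2))) ≤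
      2 * (2 ^ k * (decorr k ε * (2 ^ k * Q))) := by gcongr
  have h9 : decorr k ε * Q ≤ (2 ^ k) ^ 2 * (decorr k ε * Q) :=
    le_mul_of_one_le_left (by positivity) (one_le_pow₀ (one_le_two_pow_real k))
  linarith

end Quartic

/-! ### The main term and the error terms -/

section Assembly

variable {k : ℕ} {V : Fin k → Type u} [∀ i, Fintype (V i)] {μ : (∀ i, V i) → ℝ} {ε : ℝ}

/-- The sum of the functions `A_R ((f^{=T})²)` over the sets `T ⊇ A` of size at most `d`. -/
def levelSq (μ : (∀ i, V i) → ℝ) (d : ℕ) (R A : Finset (Fin k)) (f : (∀ i, V i) → ℝ) :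
    (∀ i, V i) → ℝ :=
  ∑ T : Finset (Fin k) with A ⊆ T ∧ #T ≤ d, avg μ R (efronStein μ T f ^ 2)

theorem avg_efronStein_sq_nonneg (hμ : ∀ x, 0 ≤ μ x) (R T : Finset (Fin k))
    (f : (∀ i, V i) → ℝ) (x : ∀ i, V i) : 0 ≤ avg μ R (efronStein μ T f ^ 2) x :=
  avg_nonneg hμ R (fun _ => sq_nonneg _) x

theorem levelSq_nonneg (hμ : ∀ x, 0 ≤ μ x) (d : ℕ) (R A : Finset (Fin k))
    (f : (∀ i, V i) → ℝ) (x : ∀ i, V i) : 0 ≤ levelSq μ d R A f x := by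
  rw [levelSq, Finset.sum_apply]
  exact sum_nonneg fun T _ => avg_efronStein_sq_nonneg hμ R T f x

theorem avg_blockSq_le (hμ : ∀ x, 0 ≤ μ x) (d : ℕ) {S A : Finset (Fin k)} (hA : A ⊆ S)
    (R : Finset (Fin k)) (f : (∀ i, V i) → ℝ) (x : ∀ i, V i) :
    avg μ R (blockSq μ d S A f) x ≤ levelSq μ d R A f x := by
  rw [blockSq, avg_sum, levelSq, Finset.sum_apply, Finset.sum_apply]
  exact sum_union_le_sum_superset hA d (φ := fun T => avg μ R (efronStein μ T f ^ 2) x)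
    fun T => avg_efronStein_sq_nonneg hμ R T f x

theorem wExpect_avg_blockSq_mul_le (hμ : ∀ x, 0 ≤ μ x) (d : ℕ) (A B R : Finset (Fin k))
    (f : (∀ i, V i) → ℝ) :
    wExpect μ (avg μ R (blockSq μ d (A ∪ B) A f) * avg μ R (blockSq μ d (A ∪ B) B f)) ≤
      wExpect μ (levelSq μ d R A f * levelSq μ d R B f) := by
  refine wExpect_mono hμ fun x _ => ?_
  exact mul_le_mul (avg_blockSq_le hμ d subset_union_left R f x)
    (avg_blockSq_le hμ d subset_union_right R f x)
    (avg_nonneg hμ R (blockSq_nonneg d _ B f) x) (levelSq_nonneg hμ d R A f x)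

theorem sum_three_pow_mul_levelSq_le (hμ : ∀ x, 0 ≤ μ x) (d : ℕ) (R : Finset (Fin k))
    (f : (∀ i, V i) → ℝ) (x : ∀ i, V i) :
    ∑ A with R ⊆ A, 3 ^ #(A \ R) * levelSq μ d R A f x ≤ 4 ^ min d k * levelSq μ d R R f x := by
  simp only [levelSq, Finset.sum_apply, mul_sum]
  calc _ = ∑ T : Finset (Fin k) with R ⊆ T ∧ #T ≤ d,
        ∑ A : Finset (Fin k) with R ⊆ A ∧ A ⊆ T,
          3 ^ #(A \ R) * avg μ R (efronStein μ T f ^ 2) x := by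
        refine sum_comm' fun A T => ?_
        simp only [mem_filter, mem_univ, true_and]
        exact ⟨fun h => ⟨⟨h.1, h.2.1⟩, h.1.trans h.2.1, h.2.2⟩,
          fun h => ⟨h.1.1, h.1.2, h.2.2⟩⟩
    _ ≤ _ := by
        refine sum_le_sum fun T hT => ?_
        obtain ⟨-, hRT, hd⟩ := mem_filter.1 hT
        rw [← sum_mul, sum_Icc_three_pow R T hRT]
        refine mul_le_mul_of_nonneg_right ?_ (avg_efronStein_sq_nonneg hμ R T f x)
        refine pow_le_pow_right₀ (by norm_num) ?_
        exact (card_le_card sdiff_subset).trans (le_min hd (card_finset_fin_le T))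

theorem three_pow_card_union (A B : Finset (Fin k)) :
    (3 : ℝ) ^ #(A ∪ B) = 3 ^ #(A ∩ B) * (3 ^ #(A \ (A ∩ B)) * 3 ^ #(B \ (A ∩ B))) := by
  rw [← pow_add, ← pow_add]
  congr 1
  have h1 := card_union_add_card_inter A B
  have h2 := card_sdiff_add_card_eq_card (inter_subset_left : A ∩ B ⊆ A)
  have h3 := card_sdiff_add_card_eq_card (inter_subset_right : A ∩ B ⊆ B)
  omega

/-- The combinatorial heart of the main term: summing over the pairs `(A, B)` with given
intersection `R` costs a factor of `4` for each element of `T \ R`, for either of two sets `T`. -/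
theorem sum_levelSq_mul_levelSq_le (hμ : ∀ x, 0 ≤ μ x) (d : ℕ) (f : (∀ i, V i) → ℝ) :
    ∑ S : Finset (Fin k), 3 ^ #S *
      ∑ p : Finset (Fin k) × Finset (Fin k) with p.1 ∪ p.2 = S,
        wExpect μ (levelSq μ d (p.1 ∩ p.2) p.1 f * levelSq μ d (p.1 ∩ p.2) p.2 f) ≤
      16 ^ min d k * ∑ R : Finset (Fin k) with #R ≤ d,
        3 ^ #R * wExpect μ (levelSq μ d R R f ^ 2) := by
  have hnn : ∀ R A B, 0 ≤ wExpect μ (levelSq μ d R A f * levelSq μ d R B f) := fun R A B =>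
    wExpect_nonneg hμ fun x =>
      mul_nonneg (levelSq_nonneg hμ d R A f x) (levelSq_nonneg hμ d R B f x)
  have h1 : ∑ S : Finset (Fin k), 3 ^ #S *
      ∑ p : Finset (Fin k) × Finset (Fin k) with p.1 ∪ p.2 = S,
        wExpect μ (levelSq μ d (p.1 ∩ p.2) p.1 f * levelSq μ d (p.1 ∩ p.2) p.2 f) =
      ∑ p : Finset (Fin k) × Finset (Fin k), 3 ^ #(p.1 ∩ p.2) *
        (3 ^ #(p.1 \ (p.1 ∩ p.2)) * 3 ^ #(p.2 \ (p.1 ∩ p.2))) *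
        wExpect μ (levelSq μ d (p.1 ∩ p.2) p.1 f * levelSq μ d (p.1 ∩ p.2) p.2 f) := by
    rw [← sum_fiberwise (s := univ)
      (g := fun p : Finset (Fin k) × Finset (Fin k) => p.1 ∪ p.2)]
    refine sum_congr rfl fun S _ => ?_
    rw [mul_sum]
    refine sum_congr rfl fun p hp => ?_
    rw [← three_pow_card_union, (mem_filter.1 hp).2]
  rw [h1]
  refine (sum_inter_le (φ := fun R A B => 3 ^ #R * (3 ^ #(A \ R) * 3 ^ #(B \ R)) *
    wExpect μ (levelSq μ d R A f * levelSq μ d R B f)) fun R A B =>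
      mul_nonneg (by positivity) (hnn R A B)).trans ?_
  have h2 : ∀ R : Finset (Fin k), ∑ A with R ⊆ A, ∑ B with R ⊆ B,
      3 ^ #R * (3 ^ #(A \ R) * 3 ^ #(B \ R)) *
        wExpect μ (levelSq μ d R A f * levelSq μ d R B f) ≤
      16 ^ min d k * (3 ^ #R * wExpect μ (levelSq μ d R R f ^ 2)) := by
    intro R
    calc _ = 3 ^ #R * wExpect μ
          ((∑ A with R ⊆ A, (3 : ℝ) ^ #(A \ R) • levelSq μ d R A f) ^ 2) := by
          rw [sq, sum_mul_sum]
          simp only [wExpect_sum, mul_sum, smul_mul_smul_comm, wExpect_smul, mul_assoc]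
      _ ≤ 3 ^ #R * wExpect μ ((((4 : ℝ) ^ min d k) • levelSq μ d R R f) ^ 2) := by
          refine mul_le_mul_of_nonneg_left (wExpect_mono hμ fun x _ => ?_) (by positivity)
          have h3 := sum_three_pow_mul_levelSq_le hμ d R f x
          have h4 : 0 ≤ ∑ A with R ⊆ A, 3 ^ #(A \ R) * levelSq μ d R A f x :=
            sum_nonneg fun A _ => mul_nonneg (by positivity) (levelSq_nonneg hμ d R A f x)
          simp only [Pi.pow_apply, Finset.sum_apply, Pi.smul_apply, smul_eq_mul]
          gcongr
      _ = _ := by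
          rw [smul_pow, wExpect_smul, ← pow_mul, mul_comm (min d k), pow_mul]
          norm_num
          ring
  refine (sum_le_sum fun R _ => h2 R).trans (le_of_eq ?_)
  rw [← mul_sum]
  congr 1
  refine (sum_filter_of_ne fun R _ hR => ?_).symm
  by_contra hd
  refine hR ?_
  have h0 : levelSq μ d R R f = 0 := by
    rw [levelSq, filter_false_of_mem, sum_empty]
    exact fun T _ hT => hd ((card_le_card hT.1).trans hT.2)
  rw [h0]
  simp [wExpect]

/-- The functions `f^{=T}` with `T ⊇ R` are almost orthogonal in the links of `R`, so that the sum
of their squared norms there is close to the influence. -/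
theorem IsEpsProduct.wExpect_levelSq_sq_le (h : IsEpsProduct ε μ) (hε : 0 ≤ ε)
    (hμ : ∀ x, 0 ≤ μ x) (d : ℕ) (R : Finset (Fin k)) (f : (∀ i, V i) → ℝ) {t : ℝ}
    (ht : 0 < t) :
    wExpect μ (levelSq μ d R R f ^ 2) ≤
      (1 + t) * wExpect μ (avg μ R (lowDegreeLaplacian μ d R f ^ 2) ^ 2) +
        (1 + 1 / t) * ((2 ^ k) ^ 4 * errTerm μ ε f) := by
  set D := univ.filter fun T : Finset (Fin k) => R ⊆ T ∧ #T ≤ d with hD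
  have h1 : lowDegreeLaplacian μ d R f ^ 2 = ∑ T ∈ D, efronStein μ T f ^ 2 +
      ∑ p ∈ D.offDiag, efronStein μ p.1 f * efronStein μ p.2 f := by
    rw [lowDegreeLaplacian_eq, sq, sum_mul_sum, ← sum_product', ← diag_union_offDiag,
      sum_union (disjoint_diag_offDiag D), sum_diag]
    simp only [sq]
  have h2 : levelSq μ d R R f = avg μ R (lowDegreeLaplacian μ d R f ^ 2) +
      ∑ p ∈ D.offDiag, (-1 : ℝ) ^ 1 • avg μ R (efronStein μ p.1 f * efronStein μ p.2 f) := by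
    rw [h1, avg_add, avg_sum, avg_sum, ← smul_sum, levelSq, ← hD]
    simp
  rw [h2]
  refine (wExpect_add_sq_le hμ _ _ ht).trans ?_
  gcongr
  rw [show ((2 : ℝ) ^ k) ^ 4 = ((2 ^ k) ^ 2) ^ 2 by ring]
  refine wExpect_sum_sq_le_of_le hμ _ _ ?_ (errTerm_nonneg hμ ε f) fun p hp => ?_
  · have h3 := card_finset_le D
    calc (#D.offDiag : ℝ) ≤ (#D : ℝ) ^ 2 := by
          rw [offDiag_card]
          exact_mod_cast (Nat.sub_le _ _).trans (sq (#D)).ge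
      _ ≤ _ := by gcongr
  · rw [smul_sign_sq]
    obtain ⟨hp1, hp2, hne⟩ := mem_offDiag.1 hp
    exact h.wExpect_avg_mul_le_errTerm hε hμ f (mem_filter.1 hp1).2.1 (mem_filter.1 hp2).2.1 hne

theorem sum_four_le {ι : Type*} (s : Finset ι) (a : ι → ℝ) :
    (∑ i ∈ s, a i) ^ 4 ≤ (#s : ℝ) ^ 3 * ∑ i ∈ s, a i ^ 4 := by
  have h1 := sq_sum_le_card_mul_sum_sq (s := s) (f := a)
  have h2 := sq_sum_le_card_mul_sum_sq (s := s) (f := fun i => a i ^ 2)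
  simp only [← pow_mul] at h2
  calc (∑ i ∈ s, a i) ^ 4 = ((∑ i ∈ s, a i) ^ 2) ^ 2 := by ring
    _ ≤ (#s * ∑ i ∈ s, a i ^ 2) ^ 2 := by gcongr
    _ = (#s : ℝ) ^ 2 * (∑ i ∈ s, a i ^ 2) ^ 2 := by ring
    _ ≤ (#s : ℝ) ^ 2 * (#s * ∑ i ∈ s, a i ^ 4) := by gcongr
    _ = _ := by ring

theorem wExpect_efronStein_pow_four_le (hμ : ∀ x, 0 ≤ μ x) (S : Finset (Fin k))
    (f : (∀ i, V i) → ℝ) :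
    wExpect μ (efronStein μ S f ^ 4) ≤ (2 ^ k) ^ 4 * wExpect μ (f ^ 4) := by
  have hf := wExpect_pow_four_nonneg hμ f
  have h1 : ∀ x, efronStein μ S f x ^ 4 ≤
      (#S.powerset : ℝ) ^ 3 * ∑ T ∈ S.powerset, avg μ T f x ^ 4 := by
    intro x
    refine (sum_four_le _ _).trans (le_of_eq ?_)
    congr 1
    refine sum_congr rfl fun T _ => ?_
    rw [mul_pow, ← pow_mul, mul_comm _ 4, pow_mul]
    norm_num
  calc wExpect μ (efronStein μ S f ^ 4)
      ≤ wExpect μ ((#S.powerset : ℝ) ^ 3 • ∑ T ∈ S.powerset, avg μ T f ^ 4) :=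
        wExpect_mono hμ fun x _ => by
          simpa only [Pi.smul_apply, Finset.sum_apply, Pi.pow_apply, smul_eq_mul] using h1 x
    _ = (#S.powerset : ℝ) ^ 3 * ∑ T ∈ S.powerset, wExpect μ (avg μ T f ^ 4) := by
        rw [wExpect_smul, wExpect_sum]
    _ ≤ (#S.powerset : ℝ) ^ 3 * ∑ T ∈ S.powerset, wExpect μ (f ^ 4) := by
        gcongr with T
        exact wExpect_avg_pow_four_le hμ T f
    _ = (#S.powerset : ℝ) ^ 4 * wExpect μ (f ^ 4) := by
        rw [sum_const, nsmul_eq_mul]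
        ring
    _ ≤ _ := by
        gcongr
        exact card_powerset_le S

theorem wExpect_pow_four_le (hμ : ∀ x, 0 ≤ μ x) {f : (∀ i, V i) → ℝ} {c : ℝ}
    (hc : ∀ x, μ x ≠ 0 → |f x| ≤ c) : wExpect μ (f ^ 4) ≤ c ^ 2 * wExpect μ (f ^ 2) := by
  rw [← wExpect_smul]
  refine wExpect_mono hμ fun x hx => ?_
  simp only [Pi.pow_apply, Pi.smul_apply, smul_eq_mul]
  have := sq_le_sq' (abs_le.1 (hc x hx)).1 (abs_le.1 (hc x hx)).2
  calc f x ^ 4 = f x ^ 2 * f x ^ 2 := by ring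
    _ ≤ _ := by gcongr

theorem abs_sum_efronStein_le (hμ : ∀ x, 0 ≤ μ x) (s : Finset (Finset (Fin k)))
    (f : (∀ i, V i) → ℝ) (x : ∀ i, V i) :
    |(∑ T ∈ s, efronStein μ T f) x| ≤ (2 ^ k) ^ 2 * supNorm μ f := by
  have hM := supNorm_nonneg (w := μ) f
  rw [Finset.sum_apply]
  refine (abs_sum_le_sum_abs _ _).trans ?_
  calc _ ≤ ∑ T ∈ s, 2 ^ k * supNorm μ f :=
        sum_le_sum fun T _ => abs_efronStein_le_supNorm hμ T f x
    _ = #s * (2 ^ k * supNorm μ f) := by simp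
    _ ≤ 2 ^ k * (2 ^ k * supNorm μ f) := by
        gcongr
        exact card_finset_le s
    _ = _ := by ring

/-- The parts of degree at most `d` of `f` nearly agree with those of `f^{≤d}`; hence their fourth
moments are controlled by that of `f^{≤d}`. -/
theorem IsEpsProduct.fourthMoments_le (h : IsEpsProduct ε μ) (hε : 0 ≤ ε)
    (hμ : ∀ x, 0 ≤ μ x) (d : ℕ) (f : (∀ i, V i) → ℝ) :
    fourthMoments μ d f ≤ 8 * (2 ^ k) ^ 7 *
      (wExpect μ (lowDegree μ d f ^ 4) + errTerm μ ε f) := by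
  have hf := wExpect_sq_nonneg hμ f
  have hM := supNorm_nonneg (w := μ) f
  have hN := one_le_two_pow_real k
  have hZ := wExpect_pow_four_nonneg hμ (lowDegree μ d f)
  have herr := errTerm_nonneg hμ ε f
  set w : (∀ i, V i) → ℝ := ∑ T : Finset (Fin k) with ¬#T ≤ d, efronStein μ T f with hw
  have key : ∀ T : Finset (Fin k), #T ≤ d → wExpect μ (efronStein μ T f ^ 4) ≤
      8 * (2 ^ k) ^ 6 * (wExpect μ (lowDegree μ d f ^ 4) + errTerm μ ε f) := by
    intro T hT
    -- `w` is the part of `f` of degree more than `d`, so that `T` contains none of its sets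
    have h1 : efronStein μ T f = efronStein μ T (lowDegree μ d f) + efronStein μ T w := by
      rw [← sub_eq_iff_eq_add', ← efronStein_sub]
      refine efronStein_congr fun x hx => ?_
      rw [Pi.sub_apply, sub_eq_iff_eq_add', lowDegree_eq, hw, Finset.sum_apply,
        Finset.sum_apply, sum_filter_add_sum_filter_not, sum_efronStein_apply hμ f hx]
    have h2 : wExpect μ (efronStein μ T w ^ 2) ≤
        (2 ^ k) ^ 2 * ((2 ^ k) ^ 2 * (decorr k ε ^ 2 * wExpect μ (f ^ 2))) := by
      rw [hw, efronStein_sum]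
      refine wExpect_sum_sq_le_of_le hμ _ _ (card_finset_le _) (by positivity) fun U hU => ?_
      refine wExpect_efronStein_sq_le_of_le hμ T _ (by positivity) fun R hR => ?_
      refine h.wExpect_avg_efronStein_sq_le hε hμ (fun hUR => ?_) f
      exact (mem_filter.1 hU).2 ((card_le_card (hUR.trans hR)).trans hT)
    have h3 : ∀ x, |efronStein μ T w x| ≤ 2 ^ k * ((2 ^ k) ^ 2 * supNorm μ f) :=
      abs_efronStein_le hμ T (by positivity) fun x _ => abs_sum_efronStein_le hμ _ f x
    have h4 : wExpect μ (efronStein μ T w ^ 4) ≤ (2 ^ k) ^ 6 * errTerm μ ε f := by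
      refine (wExpect_pow_four_le hμ fun x _ => h3 x).trans ?_
      calc _ ≤ (2 ^ k * ((2 ^ k) ^ 2 * supNorm μ f)) ^ 2 *
            ((2 ^ k) ^ 2 * ((2 ^ k) ^ 2 * (decorr k ε ^ 2 * wExpect μ (f ^ 2)))) := by gcongr
        _ = _ := by rw [errTerm]; ring
    have h5 : wExpect μ (efronStein μ T (lowDegree μ d f) ^ 4) ≤
        (2 ^ k) ^ 6 * wExpect μ (lowDegree μ d f ^ 4) := by
      refine (wExpect_efronStein_pow_four_le hμ T _).trans ?_
      exact mul_le_mul_of_nonneg_right (pow_le_pow_right₀ hN (by norm_num)) hZ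
    calc wExpect μ (efronStein μ T f ^ 4)
        ≤ wExpect μ ((8 : ℝ) • (efronStein μ T (lowDegree μ d f) ^ 4 + efronStein μ T w ^ 4)) := by
          refine wExpect_mono hμ fun x _ => ?_
          rw [h1]
          simp only [Pi.pow_apply, Pi.add_apply, Pi.smul_apply, smul_eq_mul]
          have := sum_four_le (univ : Finset (Fin 2))
            ![efronStein μ T (lowDegree μ d f) x, efronStein μ T w x]
          simp [Fin.sum_univ_two] at this
          linarith
      _ = 8 * (wExpect μ (efronStein μ T (lowDegree μ d f) ^ 4) +
          wExpect μ (efronStein μ T w ^ 4)) := by rw [wExpect_smul, wExpect_add]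
      _ ≤ 8 * ((2 ^ k) ^ 6 * wExpect μ (lowDegree μ d f ^ 4) + (2 ^ k) ^ 6 * errTerm μ ε f) := by
          gcongr
      _ = _ := by ring
  calc fourthMoments μ d f ≤ ∑ T : Finset (Fin k) with #T ≤ d,
        8 * (2 ^ k) ^ 6 * (wExpect μ (lowDegree μ d f ^ 4) + errTerm μ ε f) :=
        sum_le_sum fun T hT => key T (mem_filter.1 hT).2
    _ = #(univ.filter fun T : Finset (Fin k) => #T ≤ d) *
        (8 * (2 ^ k) ^ 6 * (wExpect μ (lowDegree μ d f ^ 4) + errTerm μ ε f)) := by simp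
    _ ≤ 2 ^ k * (8 * (2 ^ k) ^ 6 * (wExpect μ (lowDegree μ d f ^ 4) + errTerm μ ε f)) := by
        gcongr
        exact card_finset_le _
    _ = _ := by ring

/-- The bound without any saving in `ε`. -/
theorem wExpect_lowDegree_pow_four_le (hμ : ∀ x, 0 ≤ μ x) (d : ℕ) (f : (∀ i, V i) → ℝ) :
    wExpect μ (lowDegree μ d f ^ 4) ≤
      (2 ^ k) ^ 8 * (supNorm μ f ^ 2 * wExpect μ (f ^ 2)) := by
  have hf := wExpect_sq_nonneg hμ f
  rw [lowDegree_eq]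
  refine (wExpect_pow_four_le hμ fun x _ => abs_sum_efronStein_le hμ _ f x).trans ?_
  calc _ ≤ ((2 ^ k) ^ 2 * supNorm μ f) ^ 2 * ((2 ^ k) ^ 2 * ((2 ^ k) ^ 2 * wExpect μ (f ^ 2))) := by
        gcongr
        exact wExpect_sum_sq_le_of_le hμ _ _ (card_finset_le _) (by positivity) fun T _ =>
          wExpect_efronStein_sq_le hμ T f
    _ = _ := by ring

/-- The part at `S` of the square of `f^{≤d}`. -/
theorem IsEpsProduct.wExpect_efronStein_lowDegree_sq_le (h : IsEpsProduct ε μ) (hε : 0 ≤ ε)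
    (hμ : ∀ x, 0 ≤ μ x) (d : ℕ) (S : Finset (Fin k)) (f : (∀ i, V i) → ℝ) {t : ℝ}
    (ht : 0 < t) :
    wExpect μ (efronStein μ S (lowDegree μ d f ^ 2) ^ 2) ≤
      (1 + t) * (3 ^ #S * ∑ p : Finset (Fin k) × Finset (Fin k) with p.1 ∪ p.2 = S,
        wExpect μ (levelSq μ d (p.1 ∩ p.2) p.1 f * levelSq μ d (p.1 ∩ p.2) p.2 f) +
        9 ^ k * (4 * (2 ^ k) ^ 2 * (decorr k ε * fourthMoments μ d f))) +
      (1 + 1 / t) * ((2 ^ k) ^ 4 * errTerm μ ε f) := by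
  have hη := decorr_nonneg (k := k) hε
  have hQ := fourthMoments_nonneg hμ d f
  set D := univ.filter fun p : Finset (Fin k) × Finset (Fin k) => #p.1 ≤ d ∧ #p.2 ≤ d with hD
  set P := univ.filter fun p : Finset (Fin k) × Finset (Fin k) => p.1 ∪ p.2 = S with hP
  have h1 : lowDegree μ d f ^ 2 = ∑ p ∈ D, efronStein μ p.1 f * efronStein μ p.2 f := by
    rw [lowDegree_eq, sq, sum_mul_sum, ← sum_product']
    exact sum_congr (by ext p; simp [hD]) fun _ _ => rfl
  have h2 : efronStein μ S (lowDegree μ d f ^ 2) =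
      ∑ p ∈ P, efronStein μ S (pairTerm μ d p.1 p.2 f) +
      ∑ p ∈ D with ¬(p.1 ⊆ S ∪ p.2 ∧ p.2 ⊆ S ∪ p.1 ∧ S ⊆ p.1 ∪ p.2),
        efronStein μ S (efronStein μ p.1 f * efronStein μ p.2 f) := by
    rw [h1, efronStein_sum, ← sum_filter_add_sum_filter_not D
      (fun p => p.1 ⊆ S ∪ p.2 ∧ p.2 ⊆ S ∪ p.1 ∧ S ⊆ p.1 ∪ p.2), hD, filter_filter]
    congr 1
    rw [sum_good_pairs d S fun T T' => efronStein μ S (efronStein μ T f * efronStein μ T' f)]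
    refine sum_congr rfl fun p hp => ?_
    rw [pairTerm, efronStein_sum, (mem_filter.1 hp).2]
  rw [h2]
  refine (wExpect_add_sq_le hμ _ _ ht).trans ?_
  have hbad : wExpect μ ((∑ p ∈ D with ¬(p.1 ⊆ S ∪ p.2 ∧ p.2 ⊆ S ∪ p.1 ∧ S ⊆ p.1 ∪ p.2),
      efronStein μ S (efronStein μ p.1 f * efronStein μ p.2 f)) ^ 2) ≤
      (2 ^ k) ^ 4 * errTerm μ ε f := by
    rw [show ((2 : ℝ) ^ k) ^ 4 = ((2 ^ k) ^ 2) ^ 2 by ring]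
    refine wExpect_sum_sq_le_of_le hμ _ _ ?_ (errTerm_nonneg hμ ε f) fun p hp =>
      h.wExpect_efronStein_mul_le_errTerm hε hμ f (mem_filter.1 hp).2
    have h3 := card_finset_le (univ : Finset (Finset (Fin k)))
    calc _ ≤ ((#(univ : Finset (Finset (Fin k) × Finset (Fin k))) : ℕ) : ℝ) := by
          exact_mod_cast card_le_card (subset_univ _)
      _ = (#(univ : Finset (Finset (Fin k))) : ℝ) ^ 2 := by
          rw [← univ_product_univ, card_product]
          push_cast
          ring
      _ ≤ _ := by gcongr
  have hcard : (#P : ℝ) ≤ 3 ^ #S := card_union_eq_le S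
  have hS : (3 : ℝ) ^ #S ≤ 3 ^ k := pow_le_pow_right₀ (by norm_num) (card_finset_fin_le S)
  have hmain : wExpect μ ((∑ p ∈ P, efronStein μ S (pairTerm μ d p.1 p.2 f)) ^ 2) ≤
      3 ^ #S * ∑ p ∈ P,
        wExpect μ (levelSq μ d (p.1 ∩ p.2) p.1 f * levelSq μ d (p.1 ∩ p.2) p.2 f) +
        9 ^ k * (4 * (2 ^ k) ^ 2 * (decorr k ε * fourthMoments μ d f)) := by
    calc _ ≤ #P * ∑ p ∈ P, wExpect μ (efronStein μ S (pairTerm μ d p.1 p.2 f) ^ 2) :=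
          wExpect_sum_sq_le hμ _ _
      _ ≤ 3 ^ #S * ∑ p ∈ P, (wExpect μ (levelSq μ d (p.1 ∩ p.2) p.1 f *
          levelSq μ d (p.1 ∩ p.2) p.2 f) +
          4 * (2 ^ k) ^ 2 * (decorr k ε * fourthMoments μ d f)) := by
          refine mul_le_mul hcard (sum_le_sum fun p hp => ?_)
            (sum_nonneg fun p _ => wExpect_sq_nonneg hμ _) (by positivity)
          rw [← (mem_filter.1 hp).2]
          exact (h.wExpect_efronStein_pairTerm_le hε hμ d p.1 p.2 f).trans
            (add_le_add_left (wExpect_avg_blockSq_mul_le hμ d p.1 p.2 _ f) _)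
      _ = 3 ^ #S * ∑ p ∈ P,
          wExpect μ (levelSq μ d (p.1 ∩ p.2) p.1 f * levelSq μ d (p.1 ∩ p.2) p.2 f) +
          (3 ^ #S * #P) * (4 * (2 ^ k) ^ 2 * (decorr k ε * fourthMoments μ d f)) := by
          rw [sum_add_distrib, sum_const, nsmul_eq_mul]
          ring
      _ ≤ 3 ^ #S * ∑ p ∈ P,
          wExpect μ (levelSq μ d (p.1 ∩ p.2) p.1 f * levelSq μ d (p.1 ∩ p.2) p.2 f) +
          (3 ^ k * 3 ^ k) * (4 * (2 ^ k) ^ 2 * (decorr k ε * fourthMoments μ d f)) := by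
          have := hcard.trans hS
          gcongr
      _ = _ := by
          rw [← mul_pow]
          norm_num
  gcongr

end Assembly

/-! ### Hypercontractivity for `ε`-product measures -/

section Hypercontractivity

variable {k : ℕ} {V : Fin k → Type u} [∀ i, Fintype (V i)] {μ : (∀ i, V i) → ℝ} {ε : ℝ}

/-- The main term, apart from the powers of `d` and from the factor exponential in `d`. -/
def mainTerm (μ : (∀ i, V i) → ℝ) (d : ℕ) (f : (∀ i, V i) → ℝ) : ℝ :=
  ∑ R : Finset (Fin k) with #R ≤ d,
    3 ^ #R * wExpect μ (avg μ R (lowDegreeLaplacian μ d R f ^ 2) ^ 2)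

theorem mainTerm_nonneg (hμ : ∀ x, 0 ≤ μ x) (d : ℕ) (f : (∀ i, V i) → ℝ) :
    0 ≤ mainTerm μ d f :=
  sum_nonneg fun _ _ => mul_nonneg (by positivity) (wExpect_sq_nonneg hμ _)

/-- All the estimates put together. Both uses of `wExpect_add_sq_le` have the parameter `1 / 20`, and
the error terms of first order in `ε` are left on the right-hand side. -/
theorem IsEpsProduct.wExpect_lowDegree_pow_four_le_aux (h : IsEpsProduct ε μ) (hε : 0 ≤ ε)
    (hμ : ∀ x, 0 ≤ μ x) (d : ℕ) (f : (∀ i, V i) → ℝ) (hη : decorr k ε ≤ 1) :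
    wExpect μ (lowDegree μ d f ^ 4) ≤
      (21 / 20) ^ 2 * (16 ^ min d k * mainTerm μ d f) +
      (23 * 48 ^ k * (2 ^ k) ^ 5 + 34 * 9 ^ k * (2 ^ k) ^ 10 + 21 * (2 ^ k) ^ 5) *
        errTerm μ ε f +
      (34 * 9 ^ k * (2 ^ k) ^ 10 + (2 ^ k) ^ 2) *
        (decorr k ε * wExpect μ (lowDegree μ d f ^ 4)) := by
  have hη0 := decorr_nonneg (k := k) hε
  have hZ := wExpect_pow_four_nonneg hμ (lowDegree μ d f)
  have herr := errTerm_nonneg hμ ε f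
  have hQ := h.fourthMoments_le hε hμ d f
  have hZ2 : (lowDegree μ d f ^ 2) ^ 2 = lowDegree μ d f ^ 4 := by rw [← pow_mul]
  have h1 := h.wExpect_sq_le_sum hε hμ (lowDegree μ d f ^ 2)
  rw [hZ2] at h1
  set Z := wExpect μ (lowDegree μ d f ^ 4)
  set Q := fourthMoments μ d f
  set E := errTerm μ ε f
  set η := decorr k ε
  have h2 : ∑ S, wExpect μ (efronStein μ S (lowDegree μ d f ^ 2) ^ 2) ≤
      (1 + 1 / 20) * (16 ^ min d k * ∑ R : Finset (Fin k) with #R ≤ d,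
        3 ^ #R * wExpect μ (levelSq μ d R R f ^ 2)) +
      2 ^ k * ((1 + 1 / 20) * (9 ^ k * (4 * (2 ^ k) ^ 2 * (η * Q))) +
        (1 + 1 / (1 / 20)) * ((2 ^ k) ^ 4 * E)) := by
    refine (sum_le_sum fun S _ => h.wExpect_efronStein_lowDegree_sq_le hε hμ d S f
      (t := 1 / 20) (by norm_num)).trans ?_
    simp only [mul_add, sum_add_distrib, sum_const, ← mul_sum]
    have h3 := sum_levelSq_mul_levelSq_le hμ d f
    have h4 : #(univ : Finset (Finset (Fin k))) = 2 ^ k := by simp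
    simp only [h4, nsmul_eq_mul]
    push_cast
    linarith
  have h3 : ∑ R : Finset (Fin k) with #R ≤ d, 3 ^ #R * wExpect μ (levelSq μ d R R f ^ 2) ≤
      (1 + 1 / 20) * mainTerm μ d f +
        2 ^ k * (3 ^ k * ((1 + 1 / (1 / 20)) * ((2 ^ k) ^ 4 * E))) := by
    calc _ ≤ ∑ R : Finset (Fin k) with #R ≤ d, ((1 + 1 / 20) *
          (3 ^ #R * wExpect μ (avg μ R (lowDegreeLaplacian μ d R f ^ 2) ^ 2)) +
          3 ^ k * ((1 + 1 / (1 / 20)) * ((2 ^ k) ^ 4 * E))) := by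
          refine sum_le_sum fun R _ => ?_
          have h4 := h.wExpect_levelSq_sq_le hε hμ d R f (t := 1 / 20) (by norm_num)
          have h5 : (3 : ℝ) ^ #R ≤ 3 ^ k :=
            pow_le_pow_right₀ (by norm_num) (card_finset_fin_le R)
          calc _ ≤ 3 ^ #R * _ := mul_le_mul_of_nonneg_left h4 (by positivity)
            _ = (1 + 1 / 20) *
                (3 ^ #R * wExpect μ (avg μ R (lowDegreeLaplacian μ d R f ^ 2) ^ 2)) +
                3 ^ #R * ((1 + 1 / (1 / 20)) * ((2 ^ k) ^ 4 * E)) := by ring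
            _ ≤ _ := by gcongr
      _ = (1 + 1 / 20) * mainTerm μ d f + #(univ.filter fun R : Finset (Fin k) => #R ≤ d) *
          (3 ^ k * ((1 + 1 / (1 / 20)) * ((2 ^ k) ^ 4 * E))) := by
          rw [sum_add_distrib, ← mul_sum, mainTerm, sum_const, nsmul_eq_mul]
      _ ≤ _ := by
          gcongr
          exact card_finset_le _
  have h16 : (16 : ℝ) ^ min d k ≤ 16 ^ k := pow_le_pow_right₀ (by norm_num) (min_le_right d k)
  have h4 : 16 ^ min d k * ∑ R : Finset (Fin k) with #R ≤ d,
      3 ^ #R * wExpect μ (levelSq μ d R R f ^ 2) ≤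
      (1 + 1 / 20) * (16 ^ min d k * mainTerm μ d f) + 21 * 48 ^ k * (2 ^ k) ^ 5 * E := by
    calc _ ≤ 16 ^ min d k * ((1 + 1 / 20) * mainTerm μ d f +
          2 ^ k * (3 ^ k * ((1 + 1 / (1 / 20)) * ((2 ^ k) ^ 4 * E)))) :=
          mul_le_mul_of_nonneg_left h3 (by positivity)
      _ = (1 + 1 / 20) * (16 ^ min d k * mainTerm μ d f) +
          16 ^ min d k * (2 ^ k * (3 ^ k * ((1 + 1 / (1 / 20)) * ((2 ^ k) ^ 4 * E)))) := by ring
      _ ≤ (1 + 1 / 20) * (16 ^ min d k * mainTerm μ d f) +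
          16 ^ k * (2 ^ k * (3 ^ k * ((1 + 1 / (1 / 20)) * ((2 ^ k) ^ 4 * E)))) := by gcongr
      _ = _ := by
          rw [show (48 : ℝ) = 16 * 3 by norm_num, mul_pow]
          ring
  have h5 : η * Q ≤ 8 * (2 ^ k) ^ 7 * (η * Z) + 8 * (2 ^ k) ^ 7 * E := by
    calc η * Q ≤ η * (8 * (2 ^ k) ^ 7 * (Z + E)) := by gcongr
      _ = 8 * (2 ^ k) ^ 7 * (η * Z) + 8 * (2 ^ k) ^ 7 * (η * E) := by ring
      _ ≤ 8 * (2 ^ k) ^ 7 * (η * Z) + 8 * (2 ^ k) ^ 7 * (1 * E) := by gcongr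
      _ = _ := by ring
  have h6 : 2 ^ k * ((1 + 1 / 20) * (9 ^ k * (4 * (2 ^ k) ^ 2 * (η * Q)))) ≤
      34 * 9 ^ k * (2 ^ k) ^ 10 * (η * Z) + 34 * 9 ^ k * (2 ^ k) ^ 10 * E := by
    calc _ ≤ 2 ^ k * ((1 + 1 / 20) * (9 ^ k * (4 * (2 ^ k) ^ 2 *
          (8 * (2 ^ k) ^ 7 * (η * Z) + 8 * (2 ^ k) ^ 7 * E)))) := by gcongr
      _ = 33.6 * (9 ^ k * (2 ^ k) ^ 10 * (η * Z)) + 33.6 * (9 ^ k * (2 ^ k) ^ 10 * E) := by ring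
      _ ≤ 34 * (9 ^ k * (2 ^ k) ^ 10 * (η * Z)) + 34 * (9 ^ k * (2 ^ k) ^ 10 * E) := by
          gcongr <;> norm_num
      _ = _ := by ring
  have h7 : 0 ≤ 48 ^ k * (2 ^ k) ^ 5 * E := by positivity
  linarith

/-- The fourth moment bound with the constant `16`. For small `ε` the error terms containing the
left-hand side are absorbed, and for large `ε` the bound is trivial. -/
theorem IsEpsProduct.exists_wExpect_lowDegree_pow_four_le (k : ℕ) : ∃ C : ℝ, 0 < C ∧
    ∀ (V : Fin k → Type u) [∀ i, Fintype (V i)] (μ : (∀ i, V i) → ℝ) (ε : ℝ),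
      (∀ x, 0 ≤ μ x) → 0 ≤ ε → IsEpsProduct ε μ → ∀ (d : ℕ) (f : (∀ i, V i) → ℝ),
        wExpect μ (lowDegree μ d f ^ 4) ≤
          5 / 4 * (16 ^ min d k * mainTerm μ d f) +
            C * ε ^ 2 * (supNorm μ f ^ 2 * wExpect μ (f ^ 2)) := by
  set K₁ : ℝ := 23 * 48 ^ k * (2 ^ k) ^ 5 + 34 * 9 ^ k * (2 ^ k) ^ 10 + 21 * (2 ^ k) ^ 5
    with hK₁
  set K₂ : ℝ := 34 * 9 ^ k * (2 ^ k) ^ 10 + (2 ^ k) ^ 2 with hK₂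
  have hK₁0 : 0 < K₁ := by positivity
  have hK₂1 : 1 ≤ K₂ := by
    have h1 : (1 : ℝ) ≤ (2 ^ k) ^ 2 := one_le_pow₀ (one_le_two_pow_real k)
    have h2 : (0 : ℝ) ≤ 34 * 9 ^ k * (2 ^ k) ^ 10 := by positivity
    linarith
  refine ⟨2 * K₁ * (2 ^ k) ^ 4 * (2 ^ k * k ^ 2) ^ 2 +
    (2 ^ k) ^ 8 * (10 * K₂ * (2 ^ k * k ^ 2)) ^ 2 + 1, by positivity, ?_⟩
  intro V _ μ ε hμ hε h d f
  have hη0 := decorr_nonneg (k := k) hε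
  have hη : decorr k ε = 2 ^ k * k ^ 2 * ε := by rw [decorr]; ring
  have hΦ := mainTerm_nonneg hμ d f
  have hE : 0 ≤ supNorm μ f ^ 2 * wExpect μ (f ^ 2) :=
    mul_nonneg (sq_nonneg _) (wExpect_sq_nonneg hμ f)
  have hZ := wExpect_pow_four_nonneg hμ (lowDegree μ d f)
  by_cases hsmall : K₂ * decorr k ε ≤ 1 / 10
  · have hη1 : decorr k ε ≤ 1 := by nlinarith
    have h1 := h.wExpect_lowDegree_pow_four_le_aux hε hμ d f hη1
    rw [← hK₁, ← hK₂] at h1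
    -- after absorption the constant is `(21 / 20) ^ 2 / (9 / 10) < 5 / 4`
    have h2 : K₂ * (decorr k ε * wExpect μ (lowDegree μ d f ^ 4)) ≤
        1 / 10 * wExpect μ (lowDegree μ d f ^ 4) := by
      rw [← mul_assoc]
      gcongr
    have h3 : 0 ≤ 16 ^ min d k * mainTerm μ d f := by positivity
    have h4 : 0 ≤ K₁ * errTerm μ ε f := mul_nonneg hK₁0.le (errTerm_nonneg hμ ε f)
    have h5 : 2 * (K₁ * errTerm μ ε f) = 2 * K₁ * (2 ^ k) ^ 4 * (2 ^ k * k ^ 2) ^ 2 * ε ^ 2 *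
        (supNorm μ f ^ 2 * wExpect μ (f ^ 2)) := by
      rw [errTerm, hη]
      ring
    have h6 : 0 ≤ ((2 ^ k) ^ 8 * (10 * K₂ * (2 ^ k * k ^ 2)) ^ 2 + 1) * ε ^ 2 *
        (supNorm μ f ^ 2 * wExpect μ (f ^ 2)) := by positivity
    linarith
  · have h1 := wExpect_lowDegree_pow_four_le hμ d f
    have h2 : 1 ≤ (10 * K₂ * (2 ^ k * k ^ 2)) ^ 2 * ε ^ 2 := by
      rw [← mul_pow]
      refine one_le_pow₀ ?_
      rw [hη] at hsmall
      linarith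
    have h3 : (2 ^ k) ^ 8 * (supNorm μ f ^ 2 * wExpect μ (f ^ 2)) * 1 ≤
        (2 ^ k) ^ 8 * (supNorm μ f ^ 2 * wExpect μ (f ^ 2)) *
          ((10 * K₂ * (2 ^ k * k ^ 2)) ^ 2 * ε ^ 2) := by gcongr
    have h4 : 0 ≤ 16 ^ min d k * mainTerm μ d f := by positivity
    have h5 : 0 ≤ (2 * K₁ * (2 ^ k) ^ 4 * (2 ^ k * k ^ 2) ^ 2 + 1) * ε ^ 2 *
        (supNorm μ f ^ 2 * wExpect μ (f ^ 2)) := by positivity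
    linarith

theorem wExpect_proj_influence_sq (hμ : ∀ x, 0 ≤ μ x) (d : ℕ) (S : Finset (Fin k))
    (f : (∀ i, V i) → ℝ) :
    wExpect (proj μ S) (fun x => lowDegreeInfluence μ d S f x ^ 2) =
      wExpect μ (avg μ S (lowDegreeLaplacian μ d S f ^ 2) ^ 2) := by
  rw [wExpect_proj]
  simp only [lowDegreeInfluence_restrict hμ]
  rfl

theorem lowDegree_zero_pow_four (hμ : ∀ x, 0 ≤ μ x) (f : (∀ i, V i) → ℝ) :
    wExpect μ (lowDegree μ 0 f ^ 4) =
      wExpect μ (avg μ ∅ (lowDegreeLaplacian μ 0 ∅ f ^ 2) ^ 2) := by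
  have h1 : lowDegreeLaplacian μ 0 ∅ f = efronStein μ ∅ f := by
    rw [lowDegreeLaplacian_eq]
    simp [filter_eq']
  have h2 : lowDegree μ 0 f = efronStein μ ∅ f := by
    rw [lowDegree_eq]
    simp [filter_eq']
  rw [h1, h2]
  refine wExpect_congr fun x hx => ?_
  have h3 : DependsOn (efronStein μ ∅ f ^ 2) (∅ : Finset (Fin k)) := fun x y hxy => by
    rw [Pi.pow_apply, Pi.pow_apply, dependsOn_efronStein ∅ f hxy]
  rw [Pi.pow_apply, Pi.pow_apply, avg_apply_of_dependsOn hμ h3 hx, Pi.pow_apply]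
  ring

/-- Hypercontractivity for `ε`-product measures. The case `d = 0` is an equality; for `d ≥ 1` the
bound with `16 ^ d` has room to spare. -/
theorem IsEpsProduct.exists_lpNorm_lowDegree_le (k : ℕ) : ∃ C : ℝ, 0 < C ∧
    ∀ (V : Fin k → Type u) [∀ i, Fintype (V i)] (μ : (∀ i, V i) → ℝ) (ε : ℝ),
      (∀ x, 0 ≤ μ x) → IsEpsProduct ε μ → ∀ (d : ℕ) (f : (∀ i, V i) → ℝ),
        lpNorm 4 μ (lowDegree μ d f) ^ 4 ≤
          20 ^ d * ∑ S : Finset (Fin k) with #S ≤ d, (4 * (d : ℝ)) ^ #S *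
            wExpect (proj μ S) (fun x => lowDegreeInfluence μ d S f x ^ 2) +
          C * ε ^ 2 * lpNorm 2 μ f ^ 2 * supNorm μ f ^ 2 := by
  obtain ⟨C, hC, hbound⟩ := IsEpsProduct.exists_wExpect_lowDegree_pow_four_le.{u} k
  refine ⟨C, hC, fun V _ μ ε hμ h d f => ?_⟩
  have h1 := hbound V μ |ε| hμ (abs_nonneg ε) (h.mono (le_abs_self ε)) d f
  rw [sq_abs] at h1
  simp only [wExpect_proj_influence_sq hμ]
  rw [lpNorm_four_pow hμ, lpNorm_two_sq hμ]
  have hf := wExpect_sq_nonneg hμ f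
  rcases Nat.eq_zero_or_pos d with rfl | hd
  · rw [lowDegree_zero_pow_four hμ]
    have h2 : 0 ≤ C * ε ^ 2 * wExpect μ (f ^ 2) * supNorm μ f ^ 2 := by positivity
    simpa [filter_eq'] using h2
  -- for `d ≥ 1` the factor `5 / 4` is absorbed by the passage from `16 ^ d` to `20 ^ d`
  · have h2 : mainTerm μ d f ≤ ∑ S : Finset (Fin k) with #S ≤ d, (4 * (d : ℝ)) ^ #S *
        wExpect μ (avg μ S (lowDegreeLaplacian μ d S f ^ 2) ^ 2) := by
      refine sum_le_sum fun S _ => ?_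
      refine mul_le_mul_of_nonneg_right ?_ (wExpect_sq_nonneg hμ _)
      have : (1 : ℝ) ≤ d := by exact_mod_cast hd
      exact pow_le_pow_left₀ (by norm_num) (by linarith) _
    have h3 : 5 / 4 * (16 : ℝ) ^ min d k ≤ 20 ^ d := by
      have h4 : (16 : ℝ) ^ min d k ≤ 16 ^ d := pow_le_pow_right₀ (by norm_num) (min_le_left d k)
      have h5 : (5 / 4 : ℝ) ^ 1 ≤ (5 / 4) ^ d := pow_le_pow_right₀ (by norm_num) hd
      calc 5 / 4 * (16 : ℝ) ^ min d k ≤ (5 / 4) ^ d * 16 ^ d := by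
            rw [pow_one] at h5
            gcongr
        _ = 20 ^ d := by
            rw [← mul_pow]
            norm_num
    have h4 : 5 / 4 * (16 ^ min d k * mainTerm μ d f) ≤
        20 ^ d * ∑ S : Finset (Fin k) with #S ≤ d, (4 * (d : ℝ)) ^ #S *
          wExpect μ (avg μ S (lowDegreeLaplacian μ d S f ^ 2) ^ 2) := by
      rw [← mul_assoc]
      exact mul_le_mul h3 h2 (mainTerm_nonneg hμ d f) (by positivity)
    linarith

end Hypercontractivity

/-! ### Eigenvalues and pseudorandomness -/

section Spectral

variable {V : Type u} [Fintype V]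

/-- A symmetric matrix whose eigenvalues are at most `ε` in absolute value has operator norm at
most `ε`. -/
theorem norm_mulVec_le_of_eigenvalues {V : Type*} [Fintype V] [DecidableEq V] {M : Matrix V V ℝ}
    (hM : M.IsHermitian) {ε : ℝ} (hε : 0 ≤ ε) (h : ∀ i, |hM.eigenvalues i| ≤ ε) (ψ : V → ℝ) :
    ‖WithLp.toLp 2 (M.mulVec ψ)‖ ≤ ε * ‖WithLp.toLp 2 ψ‖ := by
  set b := hM.eigenvectorBasis
  have h1 : ∀ i, inner ℝ (b i) (WithLp.toLp 2 (M.mulVec ψ)) =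
      hM.eigenvalues i * inner ℝ (b i) (WithLp.toLp 2 ψ) := by
    intro i
    have h2 := hM.mulVec_eigenvectorBasis i
    have hT : M.transpose = M := (by simpa using hM : M.IsSymm)
    have h3 : ∀ v w : EuclideanSpace ℝ V, inner ℝ v w = v.ofLp ⬝ᵥ w.ofLp := by
      intro v w
      rw [EuclideanSpace.inner_eq_star_dotProduct, dotProduct_comm]
      simp
    rw [h3, h3, Matrix.dotProduct_mulVec, ← Matrix.mulVec_transpose, hT, h2, smul_dotProduct]
    rfl
  refine le_of_sq_le_sq ?_ (by positivity)
  rw [mul_pow, ← b.sum_sq_norm_inner_right, ← b.sum_sq_norm_inner_right, mul_sum]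
  refine sum_le_sum fun i _ => ?_
  rw [h1, norm_mul, mul_pow]
  have := h i
  rw [← Real.norm_eq_abs] at this
  gcongr

/-- A symmetric probability measure on `V × V` is `ε`-pseudorandom if the nontrivial eigenvalues of
the associated random walk are at most `ε` in absolute value. The walk is conjugated to a symmetric
matrix by the square roots of the stationary weights, and the eigenvalue of the constant functions
is subtracted. -/
theorem isPseudorandom_of_eigenvalues {w : V → V → ℝ} (hsymm : ∀ u v, w u v = w v u)
    (hw : ∀ u v, 0 ≤ w u v) (hw1 : ∑ u, ∑ v, w u v = 1) {ε : ℝ} (hε : 0 ≤ ε)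
    (hev : ∀ (ev : ℝ) (g : V → ℝ), g ≠ 0 → (∀ u, ∑ v, w u v = 0 → g u = 0) →
      ∑ u, (∑ v, w u v) * g u = 0 →
      (∀ u, ∑ v, w u v * g v = ev * ((∑ v, w u v) * g u)) → |ev| ≤ ε) :
    IsPseudorandom ε (fun p : V × V => w p.1 p.2) := by
  classical
  set p : V → ℝ := fun u => ∑ v, w u v with hp
  have hp0 : ∀ u, 0 ≤ p u := fun u => sum_nonneg fun v _ => hw u v
  set r : V → ℝ := fun u => √(p u) with hr
  have hrr : ∀ u, r u * r u = p u := fun u => Real.mul_self_sqrt (hp0 u)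
  have hwr : ∀ u v, r u = 0 → w u v = 0 := by
    intro u v h
    have h1 : p u = 0 := by rw [← hrr, h, zero_mul]
    exact (sum_eq_zero_iff_of_nonneg fun v _ => hw u v).1 h1 v (mem_univ v)
  have hwr' : ∀ u v, r v = 0 → w u v = 0 := fun u v h => by rw [hsymm, hwr v u h]
  set M : Matrix V V ℝ := Matrix.of fun u v => w u v / (r u * r v) - r u * r v with hMdef
  have hMapp : ∀ u v, M u v = w u v / (r u * r v) - r u * r v := fun _ _ => rfl
  have hM : M.IsHermitian := by
    ext u v
    simp [hMapp, hsymm u v, mul_comm (r u)]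
  -- the action of `M`, multiplied by `r`
  have hmul : ∀ (e : V → ℝ) u,
      r u * (M.mulVec e) u = ∑ v, w u v * (e v / r v) - p u * ∑ v, r v * e v := by
    intro e u
    simp only [Matrix.mulVec, dotProduct, hMapp, mul_sum, ← sum_sub_distrib]
    refine sum_congr rfl fun v _ => ?_
    by_cases hu : r u = 0
    · rw [hwr u v hu, ← hrr, hu]
      ring
    · rw [← hrr]
      field_simp
  have hzero : ∀ (e : V → ℝ) u, r u = 0 → (M.mulVec e) u = 0 := by
    intro e u hu
    simp only [Matrix.mulVec, dotProduct, hMapp]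
    exact sum_eq_zero fun v _ => by rw [hwr u v hu, hu]; simp
  have hMr : M.mulVec r = 0 := by
    ext u
    by_cases hu : r u = 0
    · exact hzero r u hu
    · have h1 := hmul r u
      have h2 : ∑ v, w u v * (r v / r v) = p u := by
        refine sum_congr rfl fun v _ => ?_
        by_cases hv : r v = 0
        · rw [hwr' u v hv, zero_mul]
        · rw [div_self hv, mul_one]
      have h3 : ∑ v, r v * r v = 1 := by simp only [hrr]; exact hw1
      rw [h2, h3, mul_one, sub_self] at h1
      exact (mul_eq_zero.1 h1).resolve_left hu
  have hbound : ∀ i, |hM.eigenvalues i| ≤ ε := by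
    intro i
    set ev := hM.eigenvalues i
    by_cases hev0 : ev = 0
    · rw [hev0, abs_zero]
      exact hε
    set e : V → ℝ := (hM.eigenvectorBasis i).ofLp with he
    have h1 : M.mulVec e = ev • e := hM.mulVec_eigenvectorBasis i
    have he0 : e ≠ 0 := by
      intro h0
      have h2 : hM.eigenvectorBasis i = 0 := by
        ext v
        exact congrFun h0 v
      have h3 := hM.eigenvectorBasis.norm_eq_one i
      rw [h2, norm_zero] at h3
      exact zero_ne_one h3
    have hsupp : ∀ u, r u = 0 → e u = 0 := by
      intro u hu
      have h2 := congrFun h1 u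
      rw [hzero e u hu, Pi.smul_apply, smul_eq_mul] at h2
      exact (mul_eq_zero.1 h2.symm).resolve_left hev0
    have horth : ∑ v, r v * e v = 0 := by
      have hT : M.transpose = M := (by simpa using hM : M.IsSymm)
      have h2 : r ⬝ᵥ M.mulVec e = 0 := by
        rw [Matrix.dotProduct_mulVec, ← Matrix.mulVec_transpose, hT, hMr, zero_dotProduct]
      rw [h1, dotProduct_smul, smul_eq_mul] at h2
      exact (mul_eq_zero.1 h2).resolve_left hev0
    have hpe : ∀ u, p u * (e u / r u) = r u * e u := by
      intro u
      by_cases hu : r u = 0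
      · rw [hu, ← hrr, hu]
        ring
      · rw [← hrr]
        field_simp
    refine hev ev (fun u => e u / r u) ?_ ?_ ?_ ?_
    · obtain ⟨u, hu⟩ := Function.ne_iff.1 he0
      refine Function.ne_iff.2 ⟨u, ?_⟩
      exact div_ne_zero hu fun h => hu (hsupp u h)
    · intro u hu
      have h2 : r u = 0 := by simp only [hr, hp, hu, Real.sqrt_zero]
      rw [h2, div_zero]
    · rw [← horth]
      exact sum_congr rfl fun u _ => hpe u
    · intro u
      have h2 := hmul e u
      rw [horth, mul_zero, sub_zero, h1, Pi.smul_apply, smul_eq_mul] at h2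
      rw [← h2]
      refine Eq.trans ?_ (congrArg (ev * ·) (hpe u).symm)
      ring
  intro f h
  -- expectations of functions of one coordinate
  have hE1 : ∀ φ : V → ℝ, wExpect (fun q : V × V => w q.1 q.2) (fun q => φ q.1) =
      ∑ u, p u * φ u := by
    intro φ
    simp only [wExpect, Fintype.sum_prod_type, hp, sum_mul]
  have hE2 : ∀ φ : V → ℝ, wExpect (fun q : V × V => w q.1 q.2) (fun q => φ q.2) =
      ∑ u, p u * φ u := by
    intro φ
    simp only [wExpect, Fintype.sum_prod_type, hp, sum_mul]
    rw [sum_comm]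
    exact sum_congr rfl fun u _ => sum_congr rfl fun v _ => by rw [hsymm]
  have hE : ∀ φ : V × V → ℝ, wExpect (fun q : V × V => w q.1 q.2) φ =
      ∑ u, ∑ v, w u v * φ (u, v) := fun φ => by
    simp only [wExpect, Fintype.sum_prod_type]
  simp only [wVariance, hE1, hE2 h]
  rw [hE1 fun u => (f u - ∑ u, p u * f u) ^ 2, hE2 fun u => (h u - ∑ u, p u * h u) ^ 2]
  set a := ∑ u, p u * f u with ha
  set b := ∑ u, p u * h u with hb
  have hp1 : ∑ u, p u = 1 := hw1
  set φ : V → ℝ := fun u => r u * (f u - a) with hφ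
  set ψ : V → ℝ := fun u => r u * (h u - b) with hψ
  have hnorm : ∀ (l : V → ℝ) (c : ℝ), ‖WithLp.toLp 2 (fun u => r u * (l u - c))‖ =
      √(∑ u, p u * (l u - c) ^ 2) := by
    intro l c
    rw [EuclideanSpace.norm_eq]
    congr 1
    refine sum_congr rfl fun u _ => ?_
    rw [Real.norm_eq_abs, sq_abs, mul_pow, sq (r u), hrr]
  have hrψ : ∑ v, r v * ψ v = 0 := by
    calc ∑ v, r v * ψ v = ∑ v, (p v * h v - p v * b) :=
          sum_congr rfl fun v _ => by rw [hψ, ← hrr]; ring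
      _ = 0 := by rw [sum_sub_distrib, ← sum_mul, hp1, ← hb]; ring
  have hinner : inner ℝ (WithLp.toLp 2 φ) (WithLp.toLp 2 (M.mulVec ψ)) =
      ∑ u, ∑ v, w u v * (f u * h v) - a * b := by
    have h1 : inner ℝ (WithLp.toLp 2 φ) (WithLp.toLp 2 (M.mulVec ψ)) =
        ∑ u, (f u - a) * (r u * (M.mulVec ψ) u) := by
      simp only [PiLp.inner_apply, RCLike.inner_apply, conj_trivial, hφ]
      exact sum_congr rfl fun u _ => by ring
    have h2 : ∀ u, r u * (M.mulVec ψ) u = ∑ v, w u v * (h v - b) := by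
      intro u
      rw [hmul, hrψ, mul_zero, sub_zero]
      refine sum_congr rfl fun v _ => ?_
      by_cases hv : r v = 0
      · rw [hwr' u v hv, zero_mul, zero_mul]
      · simp only [hψ]
        rw [mul_div_cancel_left₀ _ hv]
    have h3 : ∑ u, ∑ v, w u v * h v = b := by
      have := (hE2 h).symm.trans (hE _)
      rw [← hb] at this
      exact this.symm
    have h4 : ∑ u, ∑ v, w u v * f u = a := by
      have := (hE1 f).symm.trans (hE _)
      rw [← ha] at this
      exact this.symm
    have h5 : ∀ u, (f u - a) * ∑ v, w u v * (h v - b) = ∑ v, (w u v * (f u * h v) -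
        a * (w u v * h v) - b * (w u v * f u) + a * b * w u v) := by
      intro u
      rw [mul_sum]
      exact sum_congr rfl fun v _ => by ring
    rw [h1]
    simp only [h2, h5, sum_add_distrib, sum_sub_distrib, ← mul_sum]
    rw [h3, h4, hw1]
    ring
  rw [hE, ← hinner]
  calc _ ≤ ‖WithLp.toLp 2 φ‖ * ‖WithLp.toLp 2 (M.mulVec ψ)‖ := abs_real_inner_le_norm _ _
    _ ≤ ‖WithLp.toLp 2 φ‖ * (ε * ‖WithLp.toLp 2 ψ‖) := by
        gcongr
        exact norm_mulVec_le_of_eigenvalues hM hε hbound ψ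
    _ = _ := by
        rw [hnorm, hnorm, Real.sqrt_mul (sum_nonneg fun u _ => mul_nonneg (hp0 u) (sq_nonneg _))]
        ring

end Spectral

/-! ### High dimensional expanders -/

section Complex

variable {V : Type u} [Fintype V] {X : PreAbstractSimplicialComplex V} {k : ℕ} {ε : ℝ}

theorem faceMeasure_nonneg (x : Fin k → V) : 0 ≤ faceMeasure X k x := by
  rw [faceMeasure]
  split_ifs <;> positivity

theorem linkWeight_comm (X : PreAbstractSimplicialComplex V) (k : ℕ) (σ : Finset V) (u v : V) :
    linkWeight X k σ u v = linkWeight X k σ v u := by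
  classical
  rw [linkWeight, linkWeight, pair_comm]
  congr 1
  exact propext ⟨fun h => ⟨h.2.1, h.1, h.2.2.symm⟩, fun h => ⟨h.2.1, h.1, h.2.2.symm⟩⟩

theorem linkWeight_nonneg (X : PreAbstractSimplicialComplex V) (k : ℕ) (σ : Finset V) (u v : V) :
    0 ≤ linkWeight X k σ u v := by
  rw [linkWeight]
  split_ifs <;> positivity

open scoped Classical in
/-- The enumerations of a set `τ` of size `k` with prescribed values on `s` form a torsor under the
permutations of `Fin k` that fix `s` pointwise. -/
theorem card_enumerations {τ : Finset V} (hτ : #τ = k) {s : Finset (Fin k)} {f₀ : Fin k → V}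
    (hmaps : s.image f₀ ⊆ τ) (hinj : Set.InjOn f₀ s) :
    #{y : Fin k → V | (Function.Injective y ∧ univ.image y = τ) ∧ ∀ l ∈ s, y l = f₀ l} =
      #{ρ : Equiv.Perm (Fin k) | ∀ l ∈ s, ρ l = l} := by
  obtain ⟨g, hg⟩ := exists_equiv_extend_of_card_eq (by simpa using hτ.symm) hmaps hinj
  symm
  refine card_bij (fun ρ _ l => (g (ρ l) : V)) ?_ ?_ ?_
  · intro ρ hρ
    have hρ' := (mem_filter.1 hρ).2
    refine mem_filter.2 ⟨mem_univ _, ⟨?_, ?_⟩, ?_⟩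
    · exact Subtype.val_injective.comp (g.injective.comp ρ.injective)
    · ext v
      simp only [mem_image, mem_univ, true_and]
      constructor
      · rintro ⟨l, rfl⟩
        exact (g (ρ l)).2
      · intro hv
        exact ⟨ρ.symm (g.symm ⟨v, hv⟩), by simp⟩
    · intro l hl
      change (g (ρ l) : V) = f₀ l
      rw [hρ' l hl, hg l hl]
  · intro ρ _ ρ' _ h
    ext1 l
    exact g.injective (Subtype.val_injective (congrFun h l))
  · intro y hy
    obtain ⟨-, ⟨hy1, hy2⟩, hy3⟩ := mem_filter.1 hy
    have hmem : ∀ l, y l ∈ τ := fun l => hy2 ▸ mem_image_of_mem y (mem_univ l)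
    have hinj' : Function.Injective fun l => g.symm ⟨y l, hmem l⟩ := by
      intro l l' h
      exact hy1 (congrArg Subtype.val (g.symm.injective h))
    refine ⟨Equiv.ofBijective _ (Finite.injective_iff_bijective.1 hinj'), ?_, ?_⟩
    · refine mem_filter.2 ⟨mem_univ _, fun l hl => ?_⟩
      rw [Equiv.ofBijective_apply, Equiv.symm_apply_eq]
      exact Subtype.ext ((hy3 l hl).trans (hg l hl).symm)
    · ext l
      simp

open scoped Classical in
/-- The number of enumerations of `k`-faces with given coordinates in `S`, `i` and `j` is a
constant multiple of the number of `k`-faces that contain the given vertices. -/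
theorem card_tuples_eq_mul_linkWeight (X : PreAbstractSimplicialComplex V) {S : Finset (Fin k)}
    {i j : Fin k} (hi : i ∉ S) (hj : j ∉ S) (hij : i ≠ j) {y₀ : Fin k → V}
    (hy₀ : Function.Injective y₀) (u v : V) :
    (#{y : Fin k → V | (Function.Injective y ∧ univ.image y ∈ X) ∧ (∀ l ∈ S, y l = y₀ l) ∧
        y i = u ∧ y j = v} : ℝ) =
      #{ρ : Equiv.Perm (Fin k) | ∀ l ∈ insert i (insert j S), ρ l = l} *
        linkWeight X k (S.image y₀) u v := by
  rw [linkWeight]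
  split_ifs with h
  · obtain ⟨hu, hv, huv⟩ := h
    set f₀ : Fin k → V := fun l => if l = i then u else if l = j then v else y₀ l with hf₀
    have hfi : f₀ i = u := by simp [hf₀]
    have hfj : f₀ j = v := by simp [hf₀, hij.symm]
    have hfS : ∀ l ∈ S, f₀ l = y₀ l := by
      intro l hl
      have h1 : l ≠ i := fun h => hi (h ▸ hl)
      have h2 : l ≠ j := fun h => hj (h ▸ hl)
      simp [hf₀, h1, h2]
    have himage : (insert i (insert j S)).image f₀ = S.image y₀ ∪ {u, v} := by
      rw [image_insert, image_insert, hfi, hfj, image_congr fun l hl => hfS l hl]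
      ext a
      simp only [mem_insert, mem_union, mem_singleton]
      tauto
    have hcond : ∀ y : Fin k → V, ((∀ l ∈ S, y l = y₀ l) ∧ y i = u ∧ y j = v) ↔
        ∀ l ∈ insert i (insert j S), y l = f₀ l := by
      intro y
      simp only [mem_insert, forall_eq_or_imp, hfi, hfj]
      constructor
      · exact fun h => ⟨h.2.1, h.2.2, fun l hl => (h.1 l hl).trans (hfS l hl).symm⟩
      · exact fun h => ⟨fun l hl => (h.2.2 l hl).trans (hfS l hl), h.1, h.2.1⟩
    have hinj : Set.InjOn f₀ (insert i (insert j S) : Finset (Fin k)) := by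
      rw [← card_image_iff, himage, card_insert_of_notMem (by simp [hij, hi]),
        card_insert_of_notMem hj, card_union_of_disjoint, card_image_of_injective S hy₀,
        card_pair huv]
      rw [disjoint_insert_right, disjoint_singleton_right]
      exact ⟨hu, hv⟩
    have hcount : #{y : Fin k → V | (Function.Injective y ∧ univ.image y ∈ X) ∧
        (∀ l ∈ S, y l = y₀ l) ∧ y i = u ∧ y j = v} =
        ∑ τ : Finset V with τ ∈ X ∧ #τ = k ∧ S.image y₀ ∪ {u, v} ⊆ τ,
          #{ρ : Equiv.Perm (Fin k) | ∀ l ∈ insert i (insert j S), ρ l = l} := by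
      rw [card_eq_sum_card_fiberwise (f := fun y : Fin k → V => univ.image y)
        (t := univ.filter fun τ : Finset V => τ ∈ X ∧ #τ = k ∧ S.image y₀ ∪ {u, v} ⊆ τ)]
      · refine sum_congr rfl fun τ hτ => ?_
        obtain ⟨-, hτX, hτk, hτσ⟩ := mem_filter.1 hτ
        rw [← card_enumerations hτk (himage ▸ hτσ) hinj, filter_filter]
        congr 1
        ext y
        simp only [mem_filter, mem_univ, true_and, hcond]
        constructor
        · exact fun h => ⟨⟨h.1.1.1, h.2⟩, h.1.2⟩
        · exact fun h => ⟨⟨⟨h.1.1, h.1.2.symm ▸ hτX⟩, h.2⟩, h.1.2⟩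
      · intro y hy
        obtain ⟨-, ⟨hy1, hy2⟩, hy3⟩ := mem_filter.1 hy
        refine mem_coe.2 (mem_filter.2 ⟨mem_univ _, hy2, ?_, ?_⟩)
        · simp [card_image_of_injective _ hy1]
        · rw [← himage]
          intro a ha
          obtain ⟨l, hl, rfl⟩ := mem_image.1 ha
          rw [← (hcond y).1 hy3 l hl]
          exact mem_image_of_mem y (mem_univ l)
    rw [hcount, sum_const, smul_eq_mul, mul_comm]
    push_cast
    rfl
  · rw [mul_zero, Nat.cast_eq_zero, card_eq_zero, filter_eq_empty_iff]
    rintro y - ⟨⟨hy, -⟩, hyS, rfl, rfl⟩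
    refine h ⟨fun hu => ?_, fun hv => ?_, fun huv => hij (hy huv)⟩
    · obtain ⟨l, hl, hl'⟩ := mem_image.1 hu
      rw [← hyS l hl] at hl'
      exact hi (hy hl' ▸ hl)
    · obtain ⟨l, hl, hl'⟩ := mem_image.1 hv
      rw [← hyS l hl] at hl'
      exact hj (hy hl' ▸ hl)

open scoped Classical in
/-- The edges of the link of a face in a complex are distributed like the corresponding pairs of
coordinates in the link of the face measure. -/
theorem exists_pairProj_link_faceMeasure (X : PreAbstractSimplicialComplex V)
    {S : Finset (Fin k)} {i j : Fin k} (hi : i ∉ S) (hj : j ∉ S) (hij : i ≠ j)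
    {y₀ : Fin k → V} (hy₀ : Function.Injective y₀) : ∃ c : ℝ, 0 ≤ c ∧ ∀ u v,
      pairProj (V := fun _ => V) (link (faceMeasure X k) S (S.restrict y₀)) i j (u, v) =
        c * linkWeight X k (S.image y₀) u v := by
  classical
  set P := proj (V := fun _ => V) (faceMeasure X k) S (S.restrict y₀)
  have hP : 0 ≤ P := proj_nonneg faceMeasure_nonneg S _
  refine ⟨1 / (#{y : Fin k → V | Function.Injective y ∧ univ.image y ∈ X} : ℝ) / P *
    #{ρ : Equiv.Perm (Fin k) | ∀ l ∈ insert i (insert j S), ρ l = l}, by positivity, ?_⟩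
  intro u v
  rw [mul_assoc, ← card_tuples_eq_mul_linkWeight X hi hj hij hy₀]
  simp only [pairProj, link, faceMeasure]
  rw [mul_comm, ← nsmul_eq_mul, ← sum_const, sum_filter, sum_filter]
  refine sum_congr rfl fun y _ => ?_
  simp only [restrict_eq_restrict_iff]
  by_cases h1 : y i = u ∧ y j = v
  · by_cases h2 : ∀ l ∈ S, y l = y₀ l
    · by_cases h3 : Function.Injective y ∧ univ.image y ∈ X
      · rw [if_pos h1, if_pos h2, if_pos h3, if_pos ⟨h3, h2, h1⟩]
      · rw [if_pos h1, if_pos h2, if_neg h3, if_neg fun h => h3 h.1, zero_div]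
    · rw [if_pos h1, if_neg h2, if_neg fun h => h2 h.2.1]
  · rw [if_neg h1, if_neg fun h => h1 h.2.2]

/-- The uniform measure on the faces of a high dimensional expander is an `ε`-product measure. The
absolute value makes the bound on the operator norm nonnegative. -/
theorem IsHDX.isEpsProduct (h : IsHDX ε k X) :
    IsEpsProduct (V := fun _ => V) |ε| (faceMeasure X k) := by
  classical
  intro S hS x hx i j hi hj hij
  obtain ⟨y₀, hy₀, hμ⟩ := exists_ne_zero_of_sum_ne_zero hx
  obtain rfl := (mem_filter.1 hy₀).2
  have hy₀' : Function.Injective y₀ ∧ univ.image y₀ ∈ X := by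
    by_contra hc
    exact hμ (by rw [faceMeasure, if_neg hc])
  obtain ⟨c, hc0, hc⟩ := exists_pairProj_link_faceMeasure X hi hj hij hy₀'.1
  set σ := S.image y₀ with hσ
  have hσX : σ = ∅ ∨ σ ∈ X := by
    rcases S.eq_empty_or_nonempty with rfl | hne
    · exact Or.inl rfl
    · exact Or.inr ((X.isRelLowerSet_faces hy₀'.2).2 (image_subset_image (subset_univ S))
        (hne.image y₀))
  have hσk : #σ + 2 ≤ k := (Nat.add_le_add_right card_image_le 2).trans hS
  have hsum : ∑ u, ∑ v, c * linkWeight X k σ u v = 1 := by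
    have h1 := wExpect_pairProj (V := fun _ => V)
      (link (faceMeasure X k) S (S.restrict y₀)) i j fun _ => 1
    simp only [wExpect, mul_one, sum_link S hx, Fintype.sum_prod_type, hc] at h1
    exact h1
  have hc1 : c ≠ 0 := by
    rintro rfl
    simp at hsum
  have hpair : pairProj (V := fun _ => V) (link (faceMeasure X k) S (S.restrict y₀)) i j =
      fun p => c * linkWeight X k σ p.1 p.2 := funext fun p => hc p.1 p.2
  rw [hpair]
  refine isPseudorandom_of_eigenvalues (w := fun u v => c * linkWeight X k σ u v)
    (fun u v => by rw [linkWeight_comm]) (fun u v => mul_nonneg hc0 (linkWeight_nonneg _ _ _ _ _))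
    hsum (abs_nonneg ε) fun ev g hg hsupp horth heig => ?_
  have hdeg : ∀ u, ∑ v, c * linkWeight X k σ u v = c * linkDegree X k σ u := fun u => by
    rw [linkDegree, mul_sum]
  simp only [hdeg] at hsupp horth heig
  refine (h σ hσX hσk ev ⟨g, hg, fun u hu => hsupp u (by rw [hu, mul_zero]), ?_, ?_⟩).trans
    (le_abs_self ε)
  · simp only [mul_assoc, ← mul_sum] at horth
    exact (mul_eq_zero.1 horth).resolve_left hc1
  · intro u
    have h1 := heig u
    simp only [mul_assoc, ← mul_sum] at h1
    refine mul_left_cancel₀ hc1 (h1.trans ?_)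
    ring

end Complex

end EpsProduct

end

theorem mainTheorem1 (k : ℕ) :
    ∃ C : ℝ, 0 < C ∧
      (∀ (V : Fin k → Type u) [∀ i, Fintype (V i)] (μ : (∀ i, V i) → ℝ) (ε : ℝ),
        μ ∈ stdSimplex ℝ (∀ i, V i) → EpsProduct.IsEpsProduct ε μ →
        ∀ (d : ℕ) (f : (∀ i, V i) → ℝ),
          EpsProduct.lpNorm 4 μ (EpsProduct.lowDegree μ d f) ^ 4 ≤
            20 ^ d * ∑ S : Finset (Fin k) with #S ≤ d, (4 * (d : ℝ)) ^ #S *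
                EpsProduct.wExpect (EpsProduct.proj μ S)
                  (fun x => EpsProduct.lowDegreeInfluence μ d S f x ^ 2)
              + C * ε ^ 2 * EpsProduct.lpNorm 2 μ f ^ 2 * EpsProduct.supNorm μ f ^ 2) ∧
      (∀ (V : Type u) [Fintype V] (X : PreAbstractSimplicialComplex V) (ε : ℝ),
        (∃ σ ∈ X, #σ = k) → EpsProduct.IsHDX ε k X →
        ∀ (d : ℕ) (f : (Fin k → V) → ℝ),
          EpsProduct.lpNorm 4 (EpsProduct.faceMeasure X k)
              (EpsProduct.lowDegree (EpsProduct.faceMeasure X k) d f) ^ 4 ≤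
            20 ^ d * ∑ S : Finset (Fin k) with #S ≤ d, (4 * (d : ℝ)) ^ #S *
                EpsProduct.wExpect (EpsProduct.proj (EpsProduct.faceMeasure X k) S)
                  (fun x => EpsProduct.lowDegreeInfluence (EpsProduct.faceMeasure X k) d S f x ^ 2)
              + C * ε ^ 2 * EpsProduct.lpNorm 2 (EpsProduct.faceMeasure X k) f ^ 2
                  * EpsProduct.supNorm (EpsProduct.faceMeasure X k) f ^ 2) := by
  obtain ⟨C, hC, h⟩ := EpsProduct.IsEpsProduct.exists_lpNorm_lowDegree_le.{u} k
  refine ⟨C, hC, fun V _ μ ε hμ hε d f => h V μ ε hμ.1 hε d f, ?_⟩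
  intro V _ X ε _ hX d f
  have h1 := h (fun _ => V) (EpsProduct.faceMeasure X k) |ε| EpsProduct.faceMeasure_nonneg
    hX.isEpsProduct d f
  rwa [sq_abs] at h1
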